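/- A triple $(x_1,x_2,x_3)\in[0,1]^3$ is called cyclic if there exist independent real random variables $U_1,U_2,U_3$ with $P(U_i=U_j)=0$ for $i\neq j$ such that $P(U_2>U_1)=x_1$, $P(U_3>U_2)=x_2$ and $P(U_1>U_3)=x_3$. Let $C_3\subset[0,1]^3$ be the set of cyclic triples, and let $$p_3=\operatorname{vol}(C_3)=\frac{11\sqrt5}{4}-\frac{17}{4}-6\ln(\sqrt5-1)>0 .$$ Let $(X_1,X_2,X_3)$ be a random vector that is uniformly distributed (with respect to Lebesgue measure) over $C_3$, and let $X_1^*\le X_2^*\le X_3^*$ be its smallest, middle and largest coordinate. Then $X_1^*,X_2^*,X_3^*$ have the following probability densities $f_1,f_2,f_3$ on $\mathbb R$: $$f_1(x)=\begin{cases} \frac{3}{p_3}\left(x^3-3x^2+\frac{1-x}{2-x}-(1-x)\ln(1-x)\right) & \text{if } 0\le x\le\frac{3-\sqrt5}{2},\\ \frac{3}{p_3}\left(x^2-3x+1-(1-x)\ln(1-x)\right) & \text{if } \frac{3-\sqrt5}{2}<x\le\frac12,\\ \frac{3}{p_3}\left(x^2+x-1+(1-x)\ln(1-x)-2(1-x)\ln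 x\right) & \text{if } \frac12<x\le\frac{\sqrt5-1}{2},\\ 0 & \text{otherwise;}\end{cases}$$ $$f_2(x)=\begin{cases} \frac{3}{p_3}\left(3x^2-x^3\right) & \text{if } 0\le x\le\frac{3-\sqrt5}{2},\\ \frac{6}{p_3}\left(3x-x^2-\frac{1}{2(1-x)}\right) & \text{if } \frac{3-\sqrt5}{2}<x\le\frac12,\\ f_2(1-x) & \text{if } \frac12<x\le1,\\ 0 & \text{otherwise;}\end{cases}$$ $$f_3(x)=f_1(1-x)\quad\text{for all } x\in\mathbb R.$$ In particular, $f_2(1-x)=f_2(x)$ for all real $x$. -/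

import Mathlib

open MeasureTheory ProbabilityTheory

/-- The tuple `x = (x_0, …, x_{n-1})` is cyclic: there are independent real random variables
`U_0, …, U_{n-1}` without ties such that `P(U_{i+1} > U_i) = x_i` for all `i`, where indices are
taken modulo `n` (addition in `Fin n` wraps around). -/
def IsCyclicTuple {n : ℕ} [NeZero n] (x : Fin n → ℝ) : Prop :=
  ∃ (Ω : Type) (_ : MeasurableSpace Ω) (P : Measure Ω) (U : Fin n → Ω → ℝ),
    IsProbabilityMeasure P ∧
    (∀ i, Measurable (U i)) ∧
    iIndepFun U P ∧
    (∀ i j, i ≠ j → P {ω | U i ω = U j ω} = 0) ∧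
    ∀ i, P.real {ω | U (i + 1) ω > U i ω} = x i

/-- The set of cyclic triples in the unit cube `[0,1]³`. -/
def cyclicTriples : Set (Fin 3 → ℝ) :=
  {x | (∀ i, x i ∈ Set.Icc (0 : ℝ) 1) ∧ IsCyclicTuple x}

/-- The `i`-th smallest coordinate (counting from `0`) of a triple. -/
noncomputable def orderStat (i : Fin 3) (x : Fin 3 → ℝ) : ℝ :=
  x (Tuple.sort x i)

/-- The random variable `Y` has probability density function `f` with respect to
Lebesgue measure on the line. -/
def HasDensity {Ω : Type*} [MeasurableSpace Ω] (P : Measure Ω) (Y : Ω → ℝ) (f : ℝ → ℝ) : Prop :=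
  Measurable Y ∧ Measurable f ∧ (∀ x, 0 ≤ f x) ∧
    P.map Y = volume.withDensity fun x => ENNReal.ofReal (f x)

/-- The constant `p₃`. -/
noncomputable def p3 : ℝ :=
  11 * √5 / 4 - 17 / 4 - 6 * Real.log (√5 - 1)

/-- The density `f₁` of the smallest coordinate. -/
noncomputable def f1 (x : ℝ) : ℝ :=
  if 0 ≤ x ∧ x ≤ (3 - √5) / 2 then
    3 / p3 * (x ^ 3 - 3 * x ^ 2 + (1 - x) / (2 - x) - (1 - x) * Real.log (1 - x))
  else if (3 - √5) / 2 < x ∧ x ≤ 1 / 2 then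
    3 / p3 * (x ^ 2 - 3 * x + 1 - (1 - x) * Real.log (1 - x))
  else if 1 / 2 < x ∧ x ≤ (√5 - 1) / 2 then
    3 / p3 * (x ^ 2 + x - 1 + (1 - x) * Real.log (1 - x) - 2 * (1 - x) * Real.log x)
  else 0

/-- The density `f₂` of the middle coordinate on the left half `[0, 1/2]`, and `0` elsewhere. -/
noncomputable def f2Left (x : ℝ) : ℝ :=
  if 0 ≤ x ∧ x ≤ (3 - √5) / 2 then
    3 / p3 * (3 * x ^ 2 - x ^ 3)
  else if (3 - √5) / 2 < x ∧ x ≤ 1 / 2 then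
    6 / p3 * (3 * x - x ^ 2 - 1 / (2 * (1 - x)))
  else 0

/-- The density `f₂` of the middle coordinate. -/
noncomputable def f2 (x : ℝ) : ℝ :=
  if 1 / 2 < x ∧ x ≤ 1 then f2Left (1 - x) else f2Left x

open Set

/-! Condition on the first variable. Put p(u) = P(U₂ > u), q(u) = P(U₃ < u) and y = P(U₃ > U₂). The
points (p(u), q(u)) form a decreasing curve in the unit square, possibly with jumps, and its
barycentre under the law of U₁ is (x₁, x₃). By independence, a two-step staircase with corners on
the curve has area at most P(U₃ < U₂) ≤ 1 - y. If each coordinate exceeded one minus the product of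
the other two, this would fail. Indeed, if no curve point dominates a point just below the
barycentre and no chord of the curve passes above it, a line separates it from the curve,
contradicting that the barycentre is an average. Either alternative gives a staircase of area above
1 - y (`barycentre_of_curve`, `cyclic_bound`).

Hence a cyclic triple has some x_i ≤ 1 - x_j x_k and, after negating all variables, the same holds
for 1 - x. Conversely, these two conditions put a single coordinate x_i between (1 - x_j)(1 - x_k)
and 1 - x_j x_k, and every such triple is realised by laws with at most four atoms
(`isCyclicTuple_iff`).

So the set of cyclic triples is invariant under permutations and under x ↦ 1 - x, and for a ≤ b ≤ c
it is cut out by a + bc ≤ 1 and (1 - a)(1 - b) ≤ c. Up to null sets it consists of six copies of its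
sorted part, so the density of an order statistic at t is 6 / p₃ times the area of a slice of that
part (`area_slice_min`, `area_slice_middle`). Reflection gives the largest coordinate and the right
half of f₂, and integrating the middle slices gives the volume p₃. -/

/-! ### Areas of staircases in the unit square -/

lemma quadratic_gt_of_endpoints {α β γ c L t : ℝ} (hγ : 0 ≤ γ) (h0 : c < α)
    (hL : c < α + β * L - γ * L ^ 2) (ht : 0 ≤ t) (htL : t ≤ L) :
    c < α + β * t - γ * t ^ 2 := by
  rcases eq_or_lt_of_le ht with rfl | ht'
  · simpa using h0
  have hLpos : 0 < L := ht'.trans_le htL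
  have key : L * (α + β * t - γ * t ^ 2 - c) =
      (L - t) * (α - c) + t * (α + β * L - γ * L ^ 2 - c) + γ * t * L * (L - t) := by ring
  have h1 : 0 ≤ (L - t) * (α - c) := mul_nonneg (by linarith) (by linarith)
  have h2 : 0 < t * (α + β * L - γ * L ^ 2 - c) := mul_pos ht' (by linarith)
  have h3 : 0 ≤ γ * t * L * (L - t) :=
    mul_nonneg (mul_nonneg (mul_nonneg hγ ht) hLpos.le) (by linarith)
  have : 0 < L * (α + β * t - γ * t ^ 2 - c) := by rw [key]; linarith
  have := pos_of_mul_pos_right (by linarith : 0 < L * (α + β * t - γ * t ^ 2 - c)) hLpos.le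
  linarith

/-- The area of a two-step staircase whose corners lie on the upper and right sides of the unit
square. -/
lemma staircase_area_gt_of_top_right {a b l y : ℝ} (ha : 0 ≤ a) (ha' : a ≤ 1) (hb : 0 ≤ b)
    (hb' : b ≤ 1)
    (h1 : 1 < (l * a + (1 - l)) + y * (l + (1 - l) * b))
    (h2 : 1 < (l + (1 - l) * b) + y * (l * a + (1 - l)))
    (hl : 0 ≤ l) (hl' : l ≤ 1) :
    1 < a + b - a * b + y := by
  by_contra! h
  obtain ⟨u, rfl⟩ : ∃ u, a = 1 - u := ⟨1 - a, by ring⟩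
  obtain ⟨v, rfl⟩ : ∃ v, b = 1 - v := ⟨1 - b, by ring⟩
  have hy : y ≤ u * v := by nlinarith
  have hq : 0 ≤ l + (1 - l) * (1 - v) := by
    have := mul_nonneg (sub_nonneg.2 hl') hb; linarith
  have hp : 0 ≤ l * (1 - u) + (1 - l) := by
    have := mul_nonneg hl ha; linarith
  have e1 : 0 < u * (v * (l + (1 - l) * (1 - v)) - l) := by
    have := mul_le_mul_of_nonneg_right hy hq
    nlinarith
  have e2 : 0 < v * (u * (l * (1 - u) + (1 - l)) - (1 - l)) := by
    have := mul_le_mul_of_nonneg_right hy hp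
    nlinarith
  -- Cancelling u and v, then 1 - v and 1 - u, leaves l < v / (1 + v) and 1 - l < u / (1 + u).
  -- Adding these forces u v > 1, which is impossible.
  have e1' := pos_of_mul_pos_right e1 (by linarith)
  have e2' := pos_of_mul_pos_right e2 (by linarith)
  have g1 : 0 < (1 - v) * (v - l * (1 + v)) := by
    have : (1 - v) * (v - l * (1 + v)) = v * (l + (1 - l) * (1 - v)) - l := by ring
    linarith
  have g2 : 0 < (1 - u) * (u - (1 - l) * (1 + u)) := by
    have : (1 - u) * (u - (1 - l) * (1 + u)) = u * (l * (1 - u) + (1 - l)) - (1 - l) := by ring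
    linarith
  have g1' := pos_of_mul_pos_right g1 hb
  have g2' := pos_of_mul_pos_right g2 ha
  have k1 := mul_pos g1' (by linarith : (0 : ℝ) < 1 + u)
  have k2 := mul_pos g2' (by linarith : (0 : ℝ) < 1 + v)
  have k3 : u * v ≤ 1 := by nlinarith
  nlinarith

/-- The area of the union of the rectangles spanned by the origin and the points
`(p - s d, q + s e)` and `(p + t d, q - t e)`. -/
def staircaseArea (p q d e s t : ℝ) : ℝ :=
  (p - s * d) * (q + s * e) + (p + t * d) * (q - t * e) - (p - s * d) * (q - t * e)

/-- The segment through (p, q) has been prolonged until both ends lie on the boundary of the square.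
The left end is then on the left or top side and the right end on the bottom or right side, which
leaves four configurations. -/
lemma staircaseArea_gt_of_maximal {p q d e s t y : ℝ} (hd : 0 < d) (he : 0 < e) (hy : y ≤ 1)
    (h1 : 1 < p + y * q) (h2 : 1 < q + y * p)
    (hs0 : 0 ≤ s) (ht0 : 0 ≤ t) (hsp : s * d ≤ p) (hsq : s * e ≤ 1 - q)
    (htq : t * e ≤ q) (htp : t * d ≤ 1 - p)
    (hs : s * d = p ∨ s * e = 1 - q) (ht : t * e = q ∨ t * d = 1 - p)
    (hst : 0 < s + t) :
    1 < staircaseArea p q d e s t + y := by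
  unfold staircaseArea
  have hsd : 0 ≤ s * d := by positivity
  have hse : 0 ≤ s * e := by positivity
  have htd : 0 ≤ t * d := by positivity
  have hte : 0 ≤ t * e := by positivity
  have hp1 : p ≤ 1 := by linarith
  have hq1 : q ≤ 1 := by linarith
  have hcross : (s * d) * (t * e) = (s * e) * (t * d) := by ring
  rcases hs with hs | hs <;> rcases ht with ht | ht
  -- Left and bottom sides: comparing slopes gives p q ≤ (1 - p)(1 - q), so p + q ≤ 1, against `h1`
  -- and y ≤ 1.
  · exfalso
    rw [hs, ht] at hcross
    have : p * q ≤ (1 - q) * (1 - p) := by rw [hcross]; gcongr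
    have hpq : p + q ≤ 1 := by nlinarith
    have : y * q ≤ 1 * q := mul_le_mul_of_nonneg_right hy (by linarith)
    linarith
  · rw [hs, ht]
    rw [hs, ht] at hcross
    -- Left and right sides: the staircase is one rectangle of width 1 and height q - t e. The first
    -- alternative contradicts `h2`.
    have : y * p + q ≤ 1 ∨ 1 < q - t * e + y := by
      by_contra! hcon
      obtain ⟨c1, c2⟩ := hcon
      have := mul_le_mul_of_nonneg_right c2 (by linarith : 0 ≤ p)
      have : (1 - p) * (s * e) ≤ (1 - p) * (1 - q) := by gcongr
      nlinarith
    rcases this with h | h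
    · linarith
    · linarith
  · rw [hs, ht]
    rw [hs, ht] at hcross
    have : p + y * q ≤ 1 ∨ 1 < p - s * d + y := by
      by_contra! hcon
      obtain ⟨c1, c2⟩ := hcon
      have := mul_le_mul_of_nonneg_right c2 (by linarith : 0 ≤ q)
      have : (1 - q) * (t * d) ≤ (1 - q) * (1 - p) := by gcongr
      nlinarith
    rcases this with h | h
    · linarith
    · linarith
  -- Top and right sides: (p, q) divides the segment with weight t / (s + t) on the left end.
  · have hl : 0 ≤ t / (s + t) := by positivity
    have hl' : t / (s + t) ≤ 1 := by rw [div_le_one hst]; linarith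
    have ep : p = t / (s + t) * (p - s * d) + (1 - t / (s + t)) := by
      field_simp
      linear_combination s * ht
    have eq : q = t / (s + t) + (1 - t / (s + t)) * (q - t * e) := by
      field_simp
      linear_combination t * hs
    have := staircase_area_gt_of_top_right (a := p - s * d) (b := q - t * e) (y := y)
      (l := t / (s + t)) (by linarith) (by linarith) (by linarith) (by linarith)
      (by rwa [← ep, ← eq]) (by rwa [← ep, ← eq]) hl hl'
    rw [hs, ht]
    linarith

/-- The area is concave in s for fixed t and in t for fixed s, so only the corners of a parameter
rectangle matter. The rectangle is [0, S] × [0, T], where S and T are the largest values keeping the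
ends in the square. When s or t vanishes the area is at least p q and `h3` suffices; the corner (S,
T) is the maximal segment. -/
lemma staircaseArea_gt {p q d e s t y : ℝ} (hd : 0 < d) (he : 0 < e) (hy : y ≤ 1)
    (h1 : 1 < p + y * q) (h2 : 1 < q + y * p) (h3 : 1 < p * q + y)
    (hs0 : 0 ≤ s) (ht0 : 0 ≤ t) (hsp : s * d ≤ p) (hsq : s * e ≤ 1 - q)
    (htq : t * e ≤ q) (htp : t * d ≤ 1 - p) :
    1 < staircaseArea p q d e s t + y := by
  set S := min (p / d) ((1 - q) / e) with hS
  set T := min (q / e) ((1 - p) / d) with hT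
  have hsS : s ≤ S := le_min ((le_div_iff₀ hd).2 hsp) ((le_div_iff₀ he).2 hsq)
  have htT : t ≤ T := le_min ((le_div_iff₀ he).2 htq) ((le_div_iff₀ hd).2 htp)
  have hSp : S * d ≤ p := (le_div_iff₀ hd).1 (min_le_left _ _)
  have hSq : S * e ≤ 1 - q := (le_div_iff₀ he).1 (min_le_right _ _)
  have hTq : T * e ≤ q := (le_div_iff₀ he).1 (min_le_left _ _)
  have hTp : T * d ≤ 1 - p := (le_div_iff₀ hd).1 (min_le_right _ _)
  have hS' : S * d = p ∨ S * e = 1 - q := by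
    rcases min_choice (p / d) ((1 - q) / e) with h | h
    · left; rw [hS, h]; field_simp
    · right; rw [hS, h]; field_simp
  have hT' : T * e = q ∨ T * d = 1 - p := by
    rcases min_choice (q / e) ((1 - p) / d) with h | h
    · left; rw [hT, h]; field_simp
    · right; rw [hT, h]; field_simp
  have hS0 : 0 ≤ S := hs0.trans hsS
  have hT0 : 0 ≤ T := ht0.trans htT
  have form : ∀ s t, staircaseArea p q d e s t + y = (p * q + y + t * d * (q - t * e)) +
      (p * e - d * e * t) * s - (d * e) * s ^ 2 := by
    intro s t; unfold staircaseArea; ring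
  have form' : ∀ s t, staircaseArea p q d e s t + y = (p * q + y + s * e * (p - s * d)) +
      (q * d - d * e * s) * t - (d * e) * t ^ 2 := by
    intro s t; unfold staircaseArea; ring
  have hde : 0 ≤ d * e := by positivity
  have base : ∀ s, 0 ≤ s → s * d ≤ p → 1 < p * q + y + s * e * (p - s * d) := by
    intro s hs h
    have : 0 ≤ s * e * (p - s * d) := mul_nonneg (by positivity) (by linarith)
    linarith
  have base' : ∀ t, 0 ≤ t → t * e ≤ q → 1 < p * q + y + t * d * (q - t * e) := by
    intro s hs h
    have : 0 ≤ s * d * (q - s * e) := mul_nonneg (by positivity) (by linarith)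
    linarith
  have corner : 1 < staircaseArea p q d e S T + y := by
    rcases eq_or_lt_of_le (add_nonneg hS0 hT0) with h | h
    · have hSz : S = 0 := by linarith
      have hTz : T = 0 := by linarith
      rw [hSz, hTz]
      unfold staircaseArea
      linarith
    · exact staircaseArea_gt_of_maximal hd he hy h1 h2 hS0 hT0 hSp hSq hTq hTp hS' hT' h
  have side : 1 < staircaseArea p q d e s T + y := by
    rw [form] at corner ⊢
    exact quadratic_gt_of_endpoints hde (base' T hT0 hTq) corner hs0 hsS
  rw [form'] at side ⊢
  exact quadratic_gt_of_endpoints hde (base s hs0 hsp) side ht0 htT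

/-- If the segment from `(a, b')` to `(a', b)` passes weakly above `(p, q)`, then the staircase
below its endpoints is large. -/
lemma area_gt_of_segment_above {p q y a a' b b' : ℝ} (hy : y ≤ 1) (hy0 : 0 ≤ y)
    (h1 : 1 < p + y * q) (h2 : 1 < q + y * p) (h3 : 1 < p * q + y)
    (ha0 : 0 ≤ a) (hap : a < p) (hpa : p < a') (ha1 : a' ≤ 1)
    (hb0 : 0 ≤ b) (hbq : b < q) (hqb : q < b') (hb1 : b' ≤ 1)
    (hseg : (q - b) * (p - a) ≤ (b' - q) * (a' - p)) :
    1 < a * b' + a' * b - a * b + y := by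
  set d := a' - a with hd
  set e := b' - b with he
  have hdpos : 0 < d := by linarith
  have hepos : 0 < e := by linarith
  set s := (p - a) / d with hs
  set t := (a' - p) / d with ht
  have hst : s + t = 1 := by rw [hs, ht]; field_simp; linarith
  have hsd : s * d = p - a := by rw [hs]; field_simp
  have htd : t * d = a' - p := by rw [ht]; field_simp
  have hs0 : 0 ≤ s := by rw [hs]; apply div_nonneg <;> linarith
  have ht0 : 0 ≤ t := by rw [ht]; apply div_nonneg <;> linarith
  -- The height of the segment above p. The three hypotheses on (p, q) persist when q is raised to
  -- q'.
  set q' := b + t * e with hq'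
  have hqq : q ≤ q' := by
    have : 0 ≤ (q' - q) * d := by
      have : (q' - q) * d = (b' - q) * (a' - p) - (q - b) * (p - a) := by
        have : (q' - q) * d = (b - q) * d + (t * d) * e := by rw [hq']; ring
        rw [this, htd, hd, he]; ring
      linarith
    have := nonneg_of_mul_nonneg_left this hdpos
    linarith
  have hqb' : q' + s * e = b' := by
    have : s = 1 - t := by linarith
    rw [hq', this, he]; ring
  have hp0 : 0 < p := by linarith
  have := staircaseArea_gt (p := p) (q := q') (s := s) (t := t) hdpos hepos hy
    (by nlinarith) (by linarith) (by nlinarith) hs0 ht0 (by linarith) (by linarith)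
    (by linarith) (by linarith)
  unfold staircaseArea at this
  rw [hqb', hsd, htd] at this
  have e2 : q' - t * e = b := by rw [hq']; ring
  rw [e2] at this
  have e3 : p - (p - a) = a := by ring
  have e4 : p + (a' - p) = a' := by ring
  rw [e3, e4] at this
  linarith

/-! ### Barycentres of decreasing curves -/

lemma exists_lt_of_mem_upper_region {P Q y : ℝ} (h1 : 1 < P + y * Q) (h2 : 1 < Q + y * P)
    (h3 : 1 < P * Q + y) :
    ∃ ε > 0, 1 < (P - ε) + y * (Q - ε) ∧ 1 < (Q - ε) + y * (P - ε) ∧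
      1 < (P - ε) * (Q - ε) + y := by
  have c1 : Filter.Tendsto (fun ε : ℝ => (P - ε) + y * (Q - ε)) (nhdsWithin 0 (Ioi 0))
      (nhds ((P - 0) + y * (Q - 0))) :=
    ((by fun_prop : Continuous fun ε : ℝ => (P - ε) + y * (Q - ε)).tendsto 0).mono_left
      nhdsWithin_le_nhds
  have c2 : Filter.Tendsto (fun ε : ℝ => (Q - ε) + y * (P - ε)) (nhdsWithin 0 (Ioi 0))
      (nhds ((Q - 0) + y * (P - 0))) :=
    ((by fun_prop : Continuous fun ε : ℝ => (Q - ε) + y * (P - ε)).tendsto 0).mono_left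
      nhdsWithin_le_nhds
  have c3 : Filter.Tendsto (fun ε : ℝ => (P - ε) * (Q - ε) + y) (nhdsWithin 0 (Ioi 0))
      (nhds ((P - 0) * (Q - 0) + y)) :=
    ((by fun_prop : Continuous fun ε : ℝ => (P - ε) * (Q - ε) + y).tendsto 0).mono_left
      nhdsWithin_le_nhds
  simp only [sub_zero] at c1 c2 c3
  obtain ⟨ε, ⟨⟨g1, g2⟩, g3⟩, hε⟩ := (((c1.eventually (lt_mem_nhds h1)).and
    (c2.eventually (lt_mem_nhds h2))).and (c3.eventually (lt_mem_nhds h3))).and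
    self_mem_nhdsWithin |>.exists
  exact ⟨ε, hε, g1, g2, g3⟩

/-- The barycentre of a decreasing curve in the unit square with small area below it. -/
lemma barycentre_of_curve {μ : Measure ℝ} [IsProbabilityMeasure μ] {p q : ℝ → ℝ} {y : ℝ}
    (hp : Antitone p) (hq : Monotone q) (hp0 : ∀ u, 0 ≤ p u) (hp1 : ∀ u, p u ≤ 1)
    (hq0 : ∀ u, 0 ≤ q u) (hq1 : ∀ u, q u ≤ 1) (hy0 : 0 ≤ y) (hy : y ≤ 1)
    (hS : ∀ u v, u ≤ v → p v * q v + p u * q u - p v * q u + y ≤ 1) :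
    (∫ u, p u ∂μ) + y * (∫ u, q u ∂μ) ≤ 1 ∨ (∫ u, q u ∂μ) + y * (∫ u, p u ∂μ) ≤ 1 ∨
      (∫ u, p u ∂μ) * (∫ u, q u ∂μ) + y ≤ 1 := by
  have ip : Integrable p μ := by
    refine Integrable.of_bound hp.measurable.aestronglyMeasurable 1 (ae_of_all _ fun u => ?_)
    rw [Real.norm_of_nonneg (hp0 u)]; exact hp1 u
  have iq : Integrable q μ := by
    refine Integrable.of_bound hq.measurable.aestronglyMeasurable 1 (ae_of_all _ fun u => ?_)
    rw [Real.norm_of_nonneg (hq0 u)]; exact hq1 u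
  by_contra! hcon
  obtain ⟨h1, h2, h3⟩ := hcon
  obtain ⟨ε, hε, g1, g2, g3⟩ := exists_lt_of_mem_upper_region h1 h2 h3
  set P := ∫ u, p u ∂μ
  set Q := ∫ u, q u ∂μ
  have le_of_forall : ∀ (f : ℝ → ℝ) (c : ℝ), Integrable f μ → (∀ u, f u ≤ c) →
      ∫ u, f u ∂μ ≤ c := by
    intro f c hf h
    have := integral_mono hf (integrable_const c) h
    simpa using this
  have hP : P ≤ 1 := le_of_forall p 1 ip hp1
  have hQ : Q ≤ 1 := le_of_forall q 1 iq hq1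
  set P' := P - ε
  set Q' := Q - ε
  have hPP : P' < P := by simp only [P']; linarith
  have hQQ : Q' < Q := by simp only [Q']; linarith
  have hP0 : 0 ≤ P' := by
    by_contra! h
    nlinarith [mul_le_mul_of_nonneg_left hP hy0, mul_le_mul_of_nonneg_left hQ hy0]
  have hQ0 : 0 ≤ Q' := by
    by_contra! h
    nlinarith [mul_le_mul_of_nonneg_left hP hy0, mul_le_mul_of_nonneg_left hQ hy0]
  -- No curve point dominates (P', Q'): its rectangle alone would have area above 1 - y.
  have hnd : ∀ u, p u < P' ∨ q u < Q' := by
    intro u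
    by_contra! h
    have := hS u u le_rfl
    have : P' * Q' ≤ p u * q u := mul_le_mul h.1 h.2 hQ0 (hp0 u)
    linarith
  have slopes : ∀ u v, p u < P' → Q' < q u → P' < p v → q v < Q' →
      (q u - Q') * (p v - P') < (Q' - q v) * (P' - p u) := by
    intro u v hu hu' hv hv'
    by_contra! h
    have hvu : v ≤ u := by
      by_contra! h'
      have := hp h'.le
      linarith
    have := hS v u hvu
    have := area_gt_of_segment_above hy hy0 g1 g2 g3 (hp0 u) hu hv (hp1 v) (hq0 v) hv' hu'
      (hq1 u) h
    linarith
  by_cases hR : ∃ v, P' < p v ∧ q v < Q'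
  swap
  · push Not at hR
    have : P ≤ P' := le_of_forall p P' ip fun u => by
      by_contra! h
      rcases hnd u with h' | h'
      · linarith
      · exact absurd (hR u h) (not_le.2 h')
    linarith
  by_cases hL : ∃ u, p u < P' ∧ Q' < q u
  swap
  · push Not at hL
    have : Q ≤ Q' := le_of_forall q Q' iq fun u => by
      by_contra! h
      rcases hnd u with h' | h'
      · exact absurd (hL u h') (not_le.2 h)
      · linarith
    linarith
  obtain ⟨v₀, hv₀, hv₀'⟩ := hR
  obtain ⟨u₀, hu₀, hu₀'⟩ := hL
  -- Steepness of the chords from upper-left curve points to (P', Q'). By `slopes` they are bounded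
  -- by the steepness of every chord to a lower-right point, so the line of slope -sup A through
  -- (P', Q') has the whole curve weakly below it.
  set A : Set ℝ := (fun u => (q u - Q') / (P' - p u)) '' {u | p u < P' ∧ Q' < q u} with hA
  have bound : ∀ v, P' < p v → q v < Q' → ∀ x ∈ A, x ≤ (Q' - q v) / (p v - P') := by
    rintro v hv hv' _ ⟨u, ⟨hu, hu'⟩, rfl⟩
    have := slopes u v hu hu' hv hv'
    exact (div_le_div_iff₀ (by linarith) (by linarith)).2 this.le
  have hne : A.Nonempty := ⟨_, u₀, ⟨hu₀, hu₀'⟩, rfl⟩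
  have hbdd : BddAbove A := ⟨_, bound v₀ hv₀ hv₀'⟩
  set s := sSup A
  have hs0 : 0 ≤ s := by
    refine le_trans ?_ (le_csSup hbdd ⟨u₀, ⟨hu₀, hu₀'⟩, rfl⟩)
    apply div_nonneg <;> linarith
  have line : ∀ u, q u + s * p u ≤ Q' + s * P' := by
    intro u
    by_cases hu : p u < P' ∧ Q' < q u
    · have : (q u - Q') / (P' - p u) ≤ s := le_csSup hbdd ⟨u, hu, rfl⟩
      rw [div_le_iff₀ (by linarith [hu.1])] at this
      linarith
    by_cases hu' : P' < p u ∧ q u < Q'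
    · have : s ≤ (Q' - q u) / (p u - P') := csSup_le hne (bound u hu'.1 hu'.2)
      rw [le_div_iff₀ (by linarith [hu'.1])] at this
      linarith
    have a1 : p u ≤ P' := by
      by_contra! h
      rcases hnd u with h' | h'
      · linarith
      · exact hu' ⟨h, h'⟩
    have a2 : q u ≤ Q' := by
      by_contra! h
      rcases hnd u with h' | h'
      · exact hu ⟨h', h⟩
      · linarith
    have := mul_le_mul_of_nonneg_left a1 hs0
    linarith
  have := le_of_forall (fun u => q u + s * p u) _ (iq.add (ip.const_mul s)) line
  rw [integral_add iq (ip.const_mul s), integral_const_mul] at this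
  have := mul_le_mul_of_nonneg_left hPP.le hs0
  linarith

/-! ### Necessity: the inequality for independent variables -/

lemma staircase_le_prod (ν κ : Measure ℝ) [IsProbabilityMeasure ν] [IsProbabilityMeasure κ]
    {u v : ℝ} (huv : u ≤ v) :
    ν.real (Ioi v) * κ.real (Iio v) + ν.real (Ioi u) * κ.real (Iio u)
      - ν.real (Ioi v) * κ.real (Iio u) ≤ (ν.prod κ).real {z | z.2 < z.1} := by
  have hsub : (Ioi v ×ˢ Iio v) ∪ (Ioc u v ×ˢ Iio u) ⊆ {z : ℝ × ℝ | z.2 < z.1} := by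
    rintro ⟨a, b⟩ (⟨h1, h2⟩ | ⟨h1, h2⟩)
    · exact lt_trans (mem_Iio.1 h2) (mem_Ioi.1 h1)
    · exact lt_trans (mem_Iio.1 h2) h1.1
  have hdisj : Disjoint (Ioi v ×ˢ Iio v : Set (ℝ × ℝ)) (Ioc u v ×ˢ Iio u) := by
    rw [Set.disjoint_left]
    rintro ⟨a, b⟩ ⟨h1, -⟩ ⟨h2, -⟩
    exact absurd h2.2 (not_le.2 h1)
  have h := measureReal_mono (μ := ν.prod κ) hsub
  rw [measureReal_union hdisj (measurableSet_Ioc.prod measurableSet_Iio), measureReal_prod_prod,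
    measureReal_prod_prod] at h
  have hsplit : ν.real (Ioi u) = ν.real (Ioc u v) + ν.real (Ioi v) := by
    rw [← measureReal_union _ measurableSet_Ioi, Ioc_union_Ioi_eq_Ioi huv]
    exact Set.disjoint_left.2 fun a h1 h2 => absurd h1.2 (not_le.2 h2)
  rw [hsplit]
  linarith

lemma real_setOf_lt_eq_integral {Ω : Type*} [MeasurableSpace Ω] {P : Measure Ω}
    [IsProbabilityMeasure P] {U V : Ω → ℝ} (hU : Measurable U) (hV : Measurable V)
    (h : IndepFun U V P) :
    P.real {ω | U ω < V ω} = ∫ u, (P.map V).real (Ioi u) ∂(P.map U) ∧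
    P.real {ω | U ω < V ω} = ((P.map U).prod (P.map V)).real {z | z.1 < z.2} := by
  have : IsProbabilityMeasure (P.map U) := Measure.isProbabilityMeasure_map hU.aemeasurable
  have : IsProbabilityMeasure (P.map V) := Measure.isProbabilityMeasure_map hV.aemeasurable
  have hm : MeasurableSet {z : ℝ × ℝ | z.1 < z.2} := measurableSet_lt measurable_fst measurable_snd
  have e : P.real {ω | U ω < V ω} = ((P.map U).prod (P.map V)).real {z | z.1 < z.2} := by
    rw [← (indepFun_iff_map_prod_eq_prod_map_map hU.aemeasurable hV.aemeasurable).1 h,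
      map_measureReal_apply (hU.prodMk hV) hm]
    rfl
  refine ⟨?_, e⟩
  rw [e, measureReal_def, Measure.prod_apply hm]
  symm
  exact integral_toReal (measurable_measure_prodMk_left hm).aemeasurable
    (ae_of_all _ fun u => measure_lt_top _ _)

/-- By Fubini, two of the probabilities are the averages of P(V > u) and P(W < u) over the law of U.
The third plays the role of y, since the staircases lie in an event disjoint from V < W. -/
lemma cyclic_bound {Ω : Type*} [MeasurableSpace Ω] {P : Measure Ω}
    [IsProbabilityMeasure P] {U V W : Ω → ℝ} (hU : Measurable U) (hV : Measurable V)
    (hW : Measurable W) (hUV : IndepFun U V P) (hVW : IndepFun V W P) (hWU : IndepFun W U P) :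
    P.real {ω | U ω < V ω} + P.real {ω | V ω < W ω} * P.real {ω | W ω < U ω} ≤ 1 ∨
    P.real {ω | W ω < U ω} + P.real {ω | V ω < W ω} * P.real {ω | U ω < V ω} ≤ 1 ∨
    P.real {ω | V ω < W ω} + P.real {ω | U ω < V ω} * P.real {ω | W ω < U ω} ≤ 1 := by
  have : IsProbabilityMeasure (P.map U) := Measure.isProbabilityMeasure_map hU.aemeasurable
  have : IsProbabilityMeasure (P.map V) := Measure.isProbabilityMeasure_map hV.aemeasurable
  have : IsProbabilityMeasure (P.map W) := Measure.isProbabilityMeasure_map hW.aemeasurable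
  have e1 := (real_setOf_lt_eq_integral hU hV hUV).1
  have e3 : P.real {ω | W ω < U ω} = ∫ u, (P.map W).real (Iio u) ∂(P.map U) := by
    have hm : MeasurableSet {z : ℝ × ℝ | z.2 < z.1} :=
      measurableSet_lt measurable_snd measurable_fst
    have e : P.real {ω | W ω < U ω} = ((P.map U).prod (P.map W)).real {z | z.2 < z.1} := by
      rw [← (indepFun_iff_map_prod_eq_prod_map_map hU.aemeasurable hW.aemeasurable).1 hWU.symm,
        map_measureReal_apply (hU.prodMk hW) hm]
      rfl
    rw [e, measureReal_def, Measure.prod_apply hm]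
    symm
    exact integral_toReal (measurable_measure_prodMk_left hm).aemeasurable
      (ae_of_all _ fun u => measure_lt_top _ _)
  have e2 : ((P.map V).prod (P.map W)).real {z | z.2 < z.1} + P.real {ω | V ω < W ω} ≤ 1 := by
    have hm : MeasurableSet {z : ℝ × ℝ | z.2 < z.1} :=
      measurableSet_lt measurable_snd measurable_fst
    rw [(real_setOf_lt_eq_integral hV hW hVW).2, ← measureReal_union _
      (measurableSet_lt measurable_fst measurable_snd)]
    · exact measureReal_le_one
    · exact Set.disjoint_left.2 fun z (h1 : z.2 < z.1) (h2 : z.1 < z.2) => lt_asymm h1 h2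
  have := barycentre_of_curve (μ := P.map U) (p := fun u => (P.map V).real (Ioi u))
    (q := fun u => (P.map W).real (Iio u)) (y := P.real {ω | V ω < W ω})
    (fun a b hab => measureReal_mono (Ioi_subset_Ioi hab))
    (fun a b hab => measureReal_mono (Iio_subset_Iio hab))
    (fun _ => measureReal_nonneg) (fun _ => measureReal_le_one)
    (fun _ => measureReal_nonneg) (fun _ => measureReal_le_one)
    measureReal_nonneg measureReal_le_one
    (fun u v huv => by linarith [staircase_le_prod (P.map V) (P.map W) huv])
  rw [← e1, ← e3] at this
  rcases this with h | h | h
  · exact Or.inl h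
  · exact Or.inr (Or.inl h)
  · exact Or.inr (Or.inr (by linarith))

/-! ### The small-coordinate condition and symmetries of cyclic tuples -/

/-- Some coordinate of the triple `x` is at most one minus the product of the other two. -/
def HasSmallCoord (x : Fin 3 → ℝ) : Prop :=
  ∃ i j k, i ≠ j ∧ j ≠ k ∧ i ≠ k ∧ x i + x j * x k ≤ 1

lemma hasSmallCoord_iff {x : Fin 3 → ℝ} :
    HasSmallCoord x ↔ x 0 + x 1 * x 2 ≤ 1 ∨ x 1 + x 0 * x 2 ≤ 1 ∨ x 2 + x 0 * x 1 ≤ 1 := by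
  constructor
  · rintro ⟨i, j, k, h1, h2, h3, h⟩
    fin_cases i <;> fin_cases j <;> fin_cases k <;> simp_all <;>
      first | (left; linarith) | (right; left; linarith) | (right; right; linarith)
  · rintro (h | h | h)
    · exact ⟨0, 1, 2, by decide, by decide, by decide, h⟩
    · exact ⟨1, 0, 2, by decide, by decide, by decide, h⟩
    · exact ⟨2, 0, 1, by decide, by decide, by decide, h⟩

lemma HasSmallCoord.comp_perm {x : Fin 3 → ℝ} (h : HasSmallCoord x) (σ : Equiv.Perm (Fin 3)) :
    HasSmallCoord (x ∘ σ) := by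
  obtain ⟨i, j, k, h1, h2, h3, h⟩ := h
  exact ⟨σ.symm i, σ.symm j, σ.symm k, by simpa using h1, by simpa using h2, by simpa using h3,
    by simpa using h⟩

lemma IsCyclicTuple.hasSmallCoord {x : Fin 3 → ℝ} (h : IsCyclicTuple x) : HasSmallCoord x := by
  obtain ⟨Ω, _, P, U, _, hm, hind, -, hx⟩ := h
  have := cyclic_bound (hm 0) (hm 1) (hm 2) (hind.indepFun (by decide : (0 : Fin 3) ≠ 1))
    (hind.indepFun (by decide : (1 : Fin 3) ≠ 2)) (hind.indepFun (by decide : (2 : Fin 3) ≠ 0))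
  have e0 : P.real {ω | U 0 ω < U 1 ω} = x 0 := hx 0
  have e1 : P.real {ω | U 1 ω < U 2 ω} = x 1 := hx 1
  have e2 : P.real {ω | U 2 ω < U 0 ω} = x 2 := hx 2
  rw [e0, e1, e2] at this
  rw [hasSmallCoord_iff, mul_comm (x 0) (x 1)]
  tauto

/-- Negating the variables reverses each comparison, and without ties the reversed event has the
complementary probability. For n = 1 a variable is compared with itself and the claim fails. -/
lemma IsCyclicTuple.one_sub {n : ℕ} [NeZero n] (hn : n ≠ 1) {x : Fin n → ℝ}
    (h : IsCyclicTuple x) : IsCyclicTuple (1 - x) := by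
  obtain ⟨Ω, _, P, U, _, hm, hind, hne, hx⟩ := h
  refine ⟨Ω, _, P, fun i ω => -U i ω, inferInstance, fun i => (hm i).neg,
    hind.comp (fun _ t => -t) fun _ => measurable_neg, fun i j hij => by simpa using hne i j hij,
    fun i => ?_⟩
  have hi : i + 1 ≠ i := by
    intro h
    have h1 : (1 : Fin n) = 0 := by simpa using h
    have := congrArg Fin.val h1
    rw [Fin.val_one', Fin.val_zero] at this
    have hn0 := NeZero.ne n
    rw [Nat.mod_eq_of_lt (by omega)] at this
    omega
  have hmeas : MeasurableSet {ω | U (i + 1) ω > U i ω} := measurableSet_lt (hm _) (hm _)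
  have e := probReal_compl_eq_one_sub (μ := P) hmeas
  rw [hx] at e
  rw [Pi.sub_apply, Pi.one_apply, ← e]
  apply measureReal_congr
  have : ∀ᵐ ω ∂P, U (i + 1) ω ≠ U i ω := by
    rw [ae_iff]; simpa using hne _ _ hi
  filter_upwards [this] with ω hω
  apply propext
  change -U (i + 1) ω > -U i ω ↔ ¬ (U (i + 1) ω > U i ω)
  rw [gt_iff_lt, neg_lt_neg_iff, gt_iff_lt, not_lt]
  exact ⟨le_of_lt, fun h => lt_of_le_of_ne h hω⟩

lemma IsCyclicTuple.rotate {n : ℕ} [NeZero n] {x : Fin n → ℝ}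
    (h : IsCyclicTuple x) : IsCyclicTuple fun i => x (i + 1) := by
  obtain ⟨Ω, _, P, U, _, hm, hind, hne, hx⟩ := h
  exact ⟨Ω, _, P, fun i => U (i + 1), inferInstance, fun i => hm _,
    hind.precomp (add_left_injective 1),
    fun i j hij => hne _ _ fun h => hij (add_left_injective 1 h), fun i => hx (i + 1)⟩

/-! ### Sufficiency: realisation by finitely supported laws -/

lemma isCyclicTuple_of_laws (μ : Fin 3 → Measure ℝ) [∀ i, IsProbabilityMeasure (μ i)]
    {x : Fin 3 → ℝ}
    (h01 : ((μ 0).prod (μ 1)) {z | z.1 = z.2} = 0)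
    (h12 : ((μ 1).prod (μ 2)) {z | z.1 = z.2} = 0)
    (h20 : ((μ 2).prod (μ 0)) {z | z.1 = z.2} = 0)
    (h : ∀ i, ((μ i).prod (μ (i + 1))).real {z | z.1 < z.2} = x i) : IsCyclicTuple x := by
  have hind : iIndepFun (fun i (ω : Fin 3 → ℝ) => ω i) (Measure.pi μ) :=
    iIndepFun_pi (X := fun _ t => t) fun i => aemeasurable_id
  have hmap : ∀ i j, i ≠ j → (Measure.pi μ).map (fun ω => (ω i, ω j)) = (μ i).prod (μ j) := by
    intro i j hij
    rw [(indepFun_iff_map_prod_eq_prod_map_map (measurable_pi_apply i).aemeasurable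
      (measurable_pi_apply j).aemeasurable).1 (hind.indepFun hij)]
    congr 1
    · exact (measurePreserving_eval μ i).map_eq
    · exact (measurePreserving_eval μ j).map_eq
  have hmeq : MeasurableSet {z : ℝ × ℝ | z.1 = z.2} :=
    measurableSet_eq_fun measurable_fst measurable_snd
  have key : ∀ i j, i ≠ j → ((μ i).prod (μ j)) {z | z.1 = z.2} = 0 →
      (Measure.pi μ) {ω | ω i = ω j} = 0 := by
    intro i j hij h
    rw [← hmap i j hij, Measure.map_apply (by fun_prop) hmeq] at h
    exact h
  have symm : ∀ i j, (Measure.pi μ) {ω | ω i = ω j} = 0 →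
      (Measure.pi μ) {ω | ω j = ω i} = 0 := by
    intro i j h
    simpa only [eq_comm] using h
  have k01 := key 0 1 (by decide) h01
  have k12 := key 1 2 (by decide) h12
  have k20 := key 2 0 (by decide) h20
  refine ⟨Fin 3 → ℝ, inferInstance, Measure.pi μ, fun i ω => ω i, inferInstance,
    fun i => measurable_pi_apply i, hind, ?_, ?_⟩
  · intro i j hij
    fin_cases i <;> fin_cases j <;> first | exact absurd rfl hij | assumption | (apply symm; assumption)
  · intro i
    have hi : i ≠ i + 1 := by fin_cases i <;> decide
    rw [← h i, ← hmap i (i + 1) hi, map_measureReal_apply (by fun_prop)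
      (measurableSet_lt measurable_fst measurable_snd)]
    rfl

/-- The convex combination of two measures. -/
noncomputable def mixture (t : ℝ) (μ ν : Measure ℝ) : Measure ℝ :=
  ENNReal.ofReal t • μ + ENNReal.ofReal (1 - t) • ν

lemma isProbabilityMeasure_mixture {t : ℝ} (h0 : 0 ≤ t) (h1 : t ≤ 1) (μ ν : Measure ℝ)
    [IsProbabilityMeasure μ] [IsProbabilityMeasure ν] : IsProbabilityMeasure (mixture t μ ν) := by
  constructor
  simp only [mixture, Measure.add_apply, Measure.smul_apply, measure_univ, smul_eq_mul, mul_one]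
  rw [← ENNReal.ofReal_add h0 (by linarith)]
  simp

lemma mixture_prod_real {t : ℝ} (h0 : 0 ≤ t) (h1 : t ≤ 1) (μ ν κ : Measure ℝ)
    [IsFiniteMeasure μ] [IsFiniteMeasure ν] [IsFiniteMeasure κ] (s : Set (ℝ × ℝ)) :
    ((mixture t μ ν).prod κ).real s =
      t * (μ.prod κ).real s + (1 - t) * (ν.prod κ).real s := by
  have e : (mixture t μ ν).prod κ =
      ENNReal.ofReal t • (μ.prod κ) + ENNReal.ofReal (1 - t) • (ν.prod κ) := by
    rw [mixture, Measure.add_prod, Measure.prod_smul_left, Measure.prod_smul_left]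
  rw [e, measureReal_def, Measure.add_apply, Measure.smul_apply, Measure.smul_apply, smul_eq_mul,
    smul_eq_mul, ENNReal.toReal_add (by finiteness) (by finiteness), ENNReal.toReal_mul,
    ENNReal.toReal_mul, ENNReal.toReal_ofReal h0, ENNReal.toReal_ofReal (by linarith)]
  rfl

lemma prod_mixture_real {t : ℝ} (h0 : 0 ≤ t) (h1 : t ≤ 1) (μ ν κ : Measure ℝ)
    [IsFiniteMeasure μ] [IsFiniteMeasure ν] [IsFiniteMeasure κ] (s : Set (ℝ × ℝ)) :
    (κ.prod (mixture t μ ν)).real s =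
      t * (κ.prod μ).real s + (1 - t) * (κ.prod ν).real s := by
  have e : κ.prod (mixture t μ ν) =
      ENNReal.ofReal t • (κ.prod μ) + ENNReal.ofReal (1 - t) • (κ.prod ν) := by
    rw [mixture, Measure.prod_add, Measure.prod_smul_right, Measure.prod_smul_right]
  rw [e, measureReal_def, Measure.add_apply, Measure.smul_apply, Measure.smul_apply, smul_eq_mul,
    smul_eq_mul, ENNReal.toReal_add (by finiteness) (by finiteness), ENNReal.toReal_mul,
    ENNReal.toReal_mul, ENNReal.toReal_ofReal h0, ENNReal.toReal_ofReal (by linarith)]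
  rfl

lemma dirac_prod_dirac_real (a b : ℝ) {s : Set (ℝ × ℝ)} (hs : MeasurableSet s) :
    ((Measure.dirac a).prod (Measure.dirac b)).real s = s.indicator 1 (a, b) := by
  classical
  rw [Measure.dirac_prod_dirac, measureReal_def, Measure.dirac_apply' _ hs]
  by_cases h : (a, b) ∈ s <;> simp [h]

lemma isCyclicTuple_of_mem_interval {x : Fin 3 → ℝ} (hx : ∀ i, x i ∈ Icc (0 : ℝ) 1)
    (hl : (1 - x 0) * (1 - x 1) ≤ x 2) (hu : x 2 ≤ 1 - x 0 * x 1) : IsCyclicTuple x := by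
  -- s is the relative position of x 2 in its interval, whose length is x 0 + x 1 - 2 x 0 x 1; s = 0
  -- serves when the interval is a point.
  obtain ⟨s, hs0, hs1, hs⟩ : ∃ s : ℝ, 0 ≤ s ∧ s ≤ 1 ∧
      x 2 = (1 - x 0) * (1 - x 1) + s * (x 0 + x 1 - 2 * x 0 * x 1) := by
    rcases eq_or_lt_of_le (hl.trans hu) with h | h
    · exact ⟨0, le_rfl, zero_le_one, by linarith⟩
    · have hD : 0 < x 0 + x 1 - 2 * x 0 * x 1 := by nlinarith
      refine ⟨(x 2 - (1 - x 0) * (1 - x 1)) / (x 0 + x 1 - 2 * x 0 * x 1),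
        div_nonneg (by linarith) hD.le, ?_, ?_⟩
      · rw [div_le_one hD]; linarith
      · rw [div_mul_cancel₀ _ hD.ne']; ring
  obtain ⟨a0, a1⟩ := hx 0
  obtain ⟨b0, b1⟩ := hx 1
  -- With the second variable constant 0, the signs of the other two fix x 0 and x 1. When they have
  -- the same sign, s decides which of the two is larger in absolute value.
  let μ₀ := mixture (x 0) (Measure.dirac (-2)) (Measure.dirac 2)
  let μ₁ : Measure ℝ := Measure.dirac 0
  let μ₂ := mixture (x 1) (mixture s (Measure.dirac 1) (Measure.dirac 3))
    (mixture s (Measure.dirac (-3)) (Measure.dirac (-1)))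
  have i0 : IsProbabilityMeasure μ₀ := isProbabilityMeasure_mixture a0 a1 _ _
  have i2a : IsProbabilityMeasure (mixture s (Measure.dirac 1) (Measure.dirac 3)) :=
    isProbabilityMeasure_mixture hs0 hs1 _ _
  have i2b : IsProbabilityMeasure (mixture s (Measure.dirac (-3)) (Measure.dirac (-1))) :=
    isProbabilityMeasure_mixture hs0 hs1 _ _
  have i2 : IsProbabilityMeasure μ₂ := isProbabilityMeasure_mixture b0 b1 _ _
  have hlt : MeasurableSet {z : ℝ × ℝ | z.1 < z.2} := measurableSet_lt measurable_fst measurable_snd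
  have heq : MeasurableSet {z : ℝ × ℝ | z.1 = z.2} :=
    measurableSet_eq_fun measurable_fst measurable_snd
  have : ∀ i, IsProbabilityMeasure ((![μ₀, μ₁, μ₂] : Fin 3 → Measure ℝ) i) := by
    intro i
    fin_cases i
    · exact i0
    · exact (inferInstance : IsProbabilityMeasure (Measure.dirac (0 : ℝ)))
    · exact i2
  apply isCyclicTuple_of_laws ![μ₀, μ₁, μ₂]
  · rw [← measureReal_eq_zero_iff]
    change (μ₀.prod μ₁).real _ = 0
    simp only [μ₀, μ₁]
    rw [mixture_prod_real a0 a1, dirac_prod_dirac_real _ _ heq, dirac_prod_dirac_real _ _ heq]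
    norm_num [indicator]
  · rw [← measureReal_eq_zero_iff]
    change (μ₁.prod μ₂).real _ = 0
    simp only [μ₁, μ₂]
    rw [prod_mixture_real b0 b1, prod_mixture_real hs0 hs1, prod_mixture_real hs0 hs1]
    simp only [dirac_prod_dirac_real _ _ heq]
    norm_num [indicator]
  · rw [← measureReal_eq_zero_iff]
    change (μ₂.prod μ₀).real _ = 0
    simp only [μ₀, μ₂]
    rw [mixture_prod_real b0 b1, mixture_prod_real hs0 hs1, mixture_prod_real hs0 hs1]
    simp only [prod_mixture_real a0 a1, dirac_prod_dirac_real _ _ heq]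
    norm_num [indicator]
  · intro i
    fin_cases i
    · change (μ₀.prod μ₁).real _ = _
      simp only [μ₀, μ₁]
      rw [mixture_prod_real a0 a1, dirac_prod_dirac_real _ _ hlt, dirac_prod_dirac_real _ _ hlt]
      norm_num [indicator]
    · change (μ₁.prod μ₂).real _ = _
      simp only [μ₁, μ₂]
      rw [prod_mixture_real b0 b1, prod_mixture_real hs0 hs1, prod_mixture_real hs0 hs1]
      simp only [dirac_prod_dirac_real _ _ hlt]
      norm_num [indicator]
    · change (μ₂.prod μ₀).real _ = x 2
      rw [hs]
      simp only [μ₀, μ₂]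
      rw [mixture_prod_real b0 b1, mixture_prod_real hs0 hs1, mixture_prod_real hs0 hs1]
      simp only [prod_mixture_real a0 a1, dirac_prod_dirac_real _ _ hlt]
      norm_num [indicator]
      ring

lemma isCyclicTuple_of_mem_interval' {x : Fin 3 → ℝ} (hx : ∀ i, x i ∈ Icc (0 : ℝ) 1)
    (i : Fin 3) (hl : (1 - x (i + 1)) * (1 - x (i + 2)) ≤ x i)
    (hu : x i + x (i + 1) * x (i + 2) ≤ 1) : IsCyclicTuple x := by
  have h := isCyclicTuple_of_mem_interval (x := fun j => x (j + (i + 1))) (fun _ => hx _)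
  have hi : ∀ i : Fin 3, 1 + (i + 1) = i + 2 ∧ 2 + (i + 1) = i := by decide
  simp only [zero_add, (hi i).1, (hi i).2] at h
  have h := h hl (by linarith)
  fin_cases i
  · convert h.rotate.rotate using 2 with j
    fin_cases j <;> rfl
  · convert h.rotate using 2 with j
    fin_cases j <;> rfl
  · convert h using 2 with j
    fin_cases j <;> rfl

/-- If a lies below its interval, then the lower bound for b follows from `h2`. Failure of the upper
bound for b would give 1 - b < a c, hence a < a c (1 - c) ≤ a. -/
lemma exists_mem_interval {a b c : ℝ} (ha : 0 ≤ a) (hb : b ≤ 1) (hc : 0 ≤ c) (hc' : c ≤ 1)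
    (h1 : a + b * c ≤ 1) (h2 : (1 - b) + (1 - a) * (1 - c) ≤ 1) :
    ((1 - b) * (1 - c) ≤ a ∧ a + b * c ≤ 1) ∨ ((1 - a) * (1 - c) ≤ b ∧ b + a * c ≤ 1) := by
  by_contra! h
  have h3 : a < (1 - b) * (1 - c) := by
    by_contra! h'
    linarith [h.1 h']
  have h4 := h.2 (by linarith)
  have h5 : (1 - b) * (1 - c) ≤ (a * c) * (1 - c) :=
    mul_le_mul_of_nonneg_right (by linarith) (by linarith)
  have h6 : a * (c * (1 - c)) ≤ a * 1 :=
    mul_le_mul_of_nonneg_left (by nlinarith) ha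
  linarith

theorem isCyclicTuple_iff {x : Fin 3 → ℝ} (hx : ∀ i, x i ∈ Icc (0 : ℝ) 1) :
    IsCyclicTuple x ↔ HasSmallCoord x ∧ HasSmallCoord (1 - x) := by
  refine ⟨fun h => ⟨h.hasSmallCoord, (h.one_sub (by decide)).hasSmallCoord⟩, ?_⟩
  rintro ⟨h1, h2⟩
  suffices h : ∃ i : Fin 3, (1 - x (i + 1)) * (1 - x (i + 2)) ≤ x i ∧
      x i + x (i + 1) * x (i + 2) ≤ 1 by
    obtain ⟨i, hl, hu⟩ := h
    exact isCyclicTuple_of_mem_interval' hx i hl hu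
  obtain ⟨a0, a1⟩ := hx 0
  obtain ⟨b0, b1⟩ := hx 1
  obtain ⟨c0, c1⟩ := hx 2
  have r0 : (1 - x 1) * (1 - x 2) ≤ x 0 ∧ x 0 + x 1 * x 2 ≤ 1 →
      ∃ i : Fin 3, (1 - x (i + 1)) * (1 - x (i + 2)) ≤ x i ∧
      x i + x (i + 1) * x (i + 2) ≤ 1 := fun h => ⟨0, h⟩
  have r1 : (1 - x 0) * (1 - x 2) ≤ x 1 ∧ x 1 + x 0 * x 2 ≤ 1 →
      ∃ i : Fin 3, (1 - x (i + 1)) * (1 - x (i + 2)) ≤ x i ∧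
      x i + x (i + 1) * x (i + 2) ≤ 1 := fun h =>
        ⟨1, show (1 - x 2) * (1 - x 0) ≤ x 1 ∧ x 1 + x 2 * x 0 ≤ 1 by
          rwa [mul_comm (1 - x 2), mul_comm (x 2)]⟩
  have r2 : (1 - x 0) * (1 - x 1) ≤ x 2 ∧ x 2 + x 0 * x 1 ≤ 1 →
      ∃ i : Fin 3, (1 - x (i + 1)) * (1 - x (i + 2)) ≤ x i ∧
      x i + x (i + 1) * x (i + 2) ≤ 1 := fun h => ⟨2, h⟩
  rw [hasSmallCoord_iff] at h1 h2
  simp only [Pi.sub_apply, Pi.one_apply] at h2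
  rcases h1 with h1 | h1 | h1 <;> rcases h2 with h2 | h2 | h2
  · exact r0 ⟨by linarith, h1⟩
  · rcases exists_mem_interval a0 b1 c0 c1 h1 h2 with h | h
    exacts [r0 h, r1 h]
  · rcases exists_mem_interval a0 c1 b0 b1 (by linarith) h2 with h | h
    exacts [r0 (by rwa [mul_comm (1 - x 1), mul_comm (x 1)]), r2 h]
  · rcases exists_mem_interval b0 a1 c0 c1 h1 h2 with h | h
    exacts [r1 h, r0 h]
  · exact r1 ⟨by linarith, h1⟩
  · rcases exists_mem_interval b0 c1 a0 a1 (by linarith) (by linarith) with h | h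
    exacts [r1 (by rwa [mul_comm (1 - x 0), mul_comm (x 0)]),
      r2 (by rwa [mul_comm (1 - x 0), mul_comm (x 0)])]
  · rcases exists_mem_interval c0 a1 b0 b1 (by linarith) (by linarith) with h | h
    exacts [r2 h, r0 (by rwa [mul_comm (1 - x 1), mul_comm (x 1)])]
  · rcases exists_mem_interval c0 b1 a0 a1 (by linarith) (by linarith) with h | h
    exacts [r2 (by rwa [mul_comm (1 - x 0), mul_comm (x 0)]),
      r1 (by rwa [mul_comm (1 - x 0), mul_comm (x 0)])]
  · exact r2 ⟨by linarith, h1⟩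

theorem mem_cyclicTriples {x : Fin 3 → ℝ} : x ∈ cyclicTriples ↔
    (∀ i, x i ∈ Icc (0 : ℝ) 1) ∧ HasSmallCoord x ∧ HasSmallCoord (1 - x) :=
  and_congr_right isCyclicTuple_iff

/-! ### Areas of slices of the sorted region -/

/-- The triple `(a, b, c)` is cyclic and satisfies `a ≤ b ≤ c`. -/
def SortedCyclic (a b c : ℝ) : Prop :=
  0 ≤ a ∧ a ≤ b ∧ b ≤ c ∧ c ≤ 1 ∧ a + b * c ≤ 1 ∧ (1 - a) * (1 - b) ≤ c

/-- A nonnegative derivative is automatically integrable. The sign of the increment is recorded so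
that `ENNReal.ofReal` is additive over pieces and the densities come out nonnegative. -/
lemma lintegral_Ioc_of_hasDerivAt {g : ℝ → ENNReal} {h H : ℝ → ℝ} {s t : ℝ} (hst : s ≤ t)
    (hg : ∀ x ∈ Ioo s t, g x = ENNReal.ofReal (h x)) (hc : ContinuousOn H (Icc s t))
    (hH : ∀ x ∈ Ioo s t, HasDerivAt H (h x) x) (hpos : ∀ x ∈ Ioo s t, 0 ≤ h x) :
    0 ≤ H t - H s ∧ ∫⁻ x in Ioc s t, g x = ENNReal.ofReal (H t - H s) := by
  have hint := intervalIntegral.integrableOn_deriv_of_nonneg hc hH hpos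
  have hI : ∫ x in Ioc s t, h x = H t - H s := by
    rw [← intervalIntegral.integral_of_le hst]
    exact intervalIntegral.integral_eq_sub_of_hasDerivAt_of_le hst hc hH
      ((intervalIntegrable_iff_integrableOn_Ioc_of_le hst).2 hint)
  have hnn : 0 ≤ᵐ[volume.restrict (Ioc s t)] h := by
    rw [← Measure.restrict_congr_set Ioo_ae_eq_Ioc]
    exact (ae_restrict_iff' measurableSet_Ioo).2 (ae_of_all _ hpos)
  refine ⟨hI ▸ integral_nonneg_of_ae hnn, ?_⟩
  rw [← hI, ofReal_integral_eq_lintegral_ofReal hint hnn]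
  rw [← Measure.restrict_congr_set Ioo_ae_eq_Ioc]
  exact setLIntegral_congr_fun measurableSet_Ioo hg

lemma lintegral_eq_setLIntegral_Ioc {g : ℝ → ENNReal} {s t : ℝ}
    (hg : ∀ x, x ∉ Icc s t → g x = 0) : ∫⁻ x, g x = ∫⁻ x in Ioc s t, g x := by
  rw [setLIntegral_congr Ioc_ae_eq_Icc, setLIntegral_eq_of_support_subset]
  intro x hx
  by_contra h
  exact hx (hg x h)

lemma lintegral_Ioc_split {g : ℝ → ENNReal} {s t u : ℝ} (hst : s ≤ t) (htu : t ≤ u) :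
    ∫⁻ x in Ioc s u, g x = (∫⁻ x in Ioc s t, g x) + ∫⁻ x in Ioc t u, g x := by
  rw [← lintegral_union measurableSet_Ioc, Ioc_union_Ioc_eq_Ioc hst htu]
  exact Set.disjoint_left.2 fun x h1 h2 => absurd h1.2 (not_le.2 h2.1)

lemma volume_of_iff_mem_Icc {S : ℝ → Prop} {l u : ℝ} (h : ∀ c, S c ↔ l ≤ c ∧ c ≤ u) :
    volume {c | S c} = ENNReal.ofReal (u - l) := by
  have : {c | S c} = Icc l u := by ext c; exact h c
  rw [this, Real.volume_Icc]

/-- In general c runs from max(b, (1 - a)(1 - b)) to min(1, (1 - a) / b). Once a + b ≥ 1 the lower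
end is b, so only three kinds of section occur. -/
lemma volume_section_upper_one {a b : ℝ} (ha : 0 ≤ a) (hab : a ≤ b) (h1 : a + b ≤ 1)
    (h : (1 - a) * (1 - b) ≤ b) : volume {c | SortedCyclic a b c} = ENNReal.ofReal (1 - b) := by
  refine volume_of_iff_mem_Icc fun c => ⟨fun hc => ⟨hc.2.2.1, hc.2.2.2.1⟩, fun hc => ?_⟩
  exact ⟨ha, hab, hc.1, hc.2, by nlinarith, h.trans hc.1⟩

lemma volume_section_slanted {a b : ℝ} (ha : 0 ≤ a) (hab : a ≤ b) (h1 : a + b ≤ 1)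
    (h : b ≤ (1 - a) * (1 - b)) :
    volume {c | SortedCyclic a b c} = ENNReal.ofReal (1 - (1 - a) * (1 - b)) := by
  refine volume_of_iff_mem_Icc fun c => ⟨fun hc => ⟨hc.2.2.2.2.2, hc.2.2.2.1⟩, fun hc => ?_⟩
  exact ⟨ha, hab, h.trans hc.1, hc.2, by nlinarith [hc.2], hc.1⟩

lemma volume_section_hyperbola {a b : ℝ} (ha : 0 ≤ a) (hab : a ≤ b) (hb : 0 < b)
    (h1 : 1 ≤ a + b) (h : (1 - a) * (1 - b) ≤ b) :
    volume {c | SortedCyclic a b c} = ENNReal.ofReal ((1 - a) / b - b) := by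
  refine volume_of_iff_mem_Icc fun c => ⟨fun hc => ⟨hc.2.2.1, ?_⟩, fun hc => ?_⟩
  · rw [le_div_iff₀ hb]
    linarith [hc.2.2.2.2.1]
  · have h2 := hc.2
    rw [le_div_iff₀ hb] at h2
    refine ⟨ha, hab, hc.1, ?_, by linarith, h.trans hc.1⟩
    by_contra! h3
    nlinarith

lemma volume_section_eq_zero {a b : ℝ} (h : ∀ c, ¬ SortedCyclic a b c) :
    volume {c | SortedCyclic a b c} = 0 := by
  simp [h]

lemma slantedPrimitive_hasDerivAt (k x : ℝ) :
    HasDerivAt (fun x => x + k * (1 - x) ^ 2 / 2) (1 - k * (1 - x)) x := by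
  refine ((hasDerivAt_id' x).add
    (((((hasDerivAt_id' x).const_sub 1).pow 2).const_mul k).div_const 2)).congr_deriv ?_
  simp only [Nat.cast_ofNat]
  ring

lemma linearPrimitive_hasDerivAt (x : ℝ) :
    HasDerivAt (fun x : ℝ => x - x ^ 2 / 2) (1 - x) x := by
  refine ((hasDerivAt_id' x).sub (((hasDerivAt_id' x).pow 2).div_const 2)).congr_deriv ?_
  simp only [Nat.cast_ofNat]
  ring

lemma hyperbolaPrimitive_hasDerivAt (k : ℝ) {x : ℝ} (hx : x ≠ 0) :
    HasDerivAt (fun x => k * Real.log x - x ^ 2 / 2) (k / x - x) x := by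
  refine (((Real.hasDerivAt_log hx).const_mul k).sub
    (((hasDerivAt_id' x).pow 2).div_const 2)).congr_deriv ?_
  simp only [Nat.cast_ofNat]
  ring

lemma sq_sqrt_five : √5 ^ 2 = (5 : ℝ) := Real.sq_sqrt (by norm_num)

lemma two_lt_sqrt_five : 2 < √5 := by
  rw [Real.lt_sqrt] <;> norm_num

lemma sqrt_five_lt : √5 < 2.24 := by
  rw [Real.sqrt_lt'] <;> norm_num

lemma p3_pos : 0 < p3 := by
  have h1 := two_lt_sqrt_five
  have : Real.log (√5 - 1) ≤ √5 - 1 - 1 := Real.log_le_sub_one_of_pos (by linarith)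
  unfold p3
  nlinarith [sqrt_five_lt, h1, this]

/-- The bound is the smaller root of x² - 3x + 1, where the curve b = (1 - a)(1 - b) meets the
diagonal a = b. -/
lemma le_root_iff {x : ℝ} (hx : x ≤ 1) : x ≤ (3 - √5) / 2 ↔ 0 ≤ x ^ 2 - 3 * x + 1 := by
  have h1 := two_lt_sqrt_five
  have h2 := sq_sqrt_five
  have e : x ^ 2 - 3 * x + 1 = ((3 - √5) / 2 - x) * ((3 + √5) / 2 - x) := by nlinarith
  have h3 : 0 < (3 + √5) / 2 - x := by linarith
  rw [e, mul_nonneg_iff_of_pos_right h3, sub_nonneg]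

/-- Here the curve b² = 1 - a, on which the hyperbolic section shrinks to a point, meets the
diagonal. -/
lemma le_golden_iff {x : ℝ} (hx : 0 ≤ x) : x ≤ (√5 - 1) / 2 ↔ x ^ 2 + x ≤ 1 := by
  have h1 := two_lt_sqrt_five
  have h2 := sq_sqrt_five
  have e : 1 - (x ^ 2 + x) = ((√5 - 1) / 2 - x) * ((√5 + 1) / 2 + x) := by nlinarith
  have h3 : 0 < (√5 + 1) / 2 + x := by linarith
  rw [← sub_nonneg (b := x ^ 2 + x), e, mul_nonneg_iff_of_pos_right h3, sub_nonneg]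

set_option maxHeartbeats 1000000 in
/-- The area of the slice of the sorted cyclic triples with prescribed smallest coordinate. -/
lemma area_slice_min (a : ℝ) : 0 ≤ f1 a ∧
    ∫⁻ b, volume {c | SortedCyclic a b c} = ENNReal.ofReal (p3 / 6 * f1 a) := by
  have hp := p3_pos
  have h5 := two_lt_sqrt_five
  have h5' := sqrt_five_lt
  suffices h : ∃ v, f1 a = 3 / p3 * (2 * v) ∧ 0 ≤ v ∧
      ∫⁻ b, volume {c | SortedCyclic a b c} = ENNReal.ofReal v by
    obtain ⟨v, hv, hv0, h⟩ := h
    refine ⟨by rw [hv]; positivity, ?_⟩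
    rw [h, hv]
    congr 1
    field_simp
    ring
  by_cases hdom : a < 0 ∨ (√5 - 1) / 2 < a
  · refine ⟨0, ?_, le_rfl, ?_⟩
    · unfold f1
      rw [if_neg, if_neg, if_neg]
      · simp
      all_goals rintro ⟨g1, g2⟩; rcases hdom with h | h <;> linarith
    · have : ∀ b c, ¬ SortedCyclic a b c := by
        rintro b c ⟨g1, g2, g3, g4, g5, g6⟩
        rcases hdom with h | h
        · linarith
        · refine absurd ((le_golden_iff g1).2 ?_) (not_le.2 h)
          nlinarith [mul_le_mul g2 (g2.trans g3) g1 (g1.trans g2)]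
      simp [this]
  push Not at hdom
  obtain ⟨ha, hag⟩ := hdom
  have ha1 : a < 1 := by linarith
  have hgold : a ^ 2 + a ≤ 1 := (le_golden_iff ha).1 hag
  set m := √(1 - a) with hm
  have hm2 : m ^ 2 = 1 - a := Real.sq_sqrt (by linarith)
  have hm0 : 0 < m := Real.sqrt_pos.2 (by linarith)
  have hlogm : Real.log m = Real.log (1 - a) / 2 := Real.log_sqrt (by linarith)
  have ham : a ≤ m := by
    refine Real.le_sqrt_of_sq_le ?_
    linarith
  have h1am : 1 - a ≤ m := by
    refine Real.le_sqrt_of_sq_le ?_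
    nlinarith
  have hsupp : ∀ b, b ∉ Icc a m → volume {c | SortedCyclic a b c} = 0 := by
    intro b hb
    refine volume_section_eq_zero ?_
    rintro c ⟨g1, g2, g3, g4, g5, g6⟩
    refine hb ⟨g2, ?_⟩
    refine Real.le_sqrt_of_sq_le ?_
    nlinarith
  rw [lintegral_eq_setLIntegral_Ioc hsupp]
  have pieceC : ∀ s, a ≤ s → 1 - a ≤ s → 0 < s → (1 - a) * (1 - s) ≤ s → s ≤ m →
      0 ≤ ((1 - a) * Real.log m - m ^ 2 / 2) - ((1 - a) * Real.log s - s ^ 2 / 2) ∧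
      ∫⁻ b in Ioc s m, volume {c | SortedCyclic a b c} = ENNReal.ofReal
        (((1 - a) * Real.log m - m ^ 2 / 2) - ((1 - a) * Real.log s - s ^ 2 / 2)) := by
    intro s hs hs' hs0 hs1 hsm
    refine lintegral_Ioc_of_hasDerivAt (h := fun b => (1 - a) / b - b)
      (H := fun b => (1 - a) * Real.log b - b ^ 2 / 2) hsm ?_ ?_ ?_ ?_
    · intro b hb
      exact volume_section_hyperbola ha (hs.trans hb.1.le) (hs0.trans hb.1)
        (by linarith [hb.1]) (by nlinarith [hb.1])
    · intro b hb
      exact (hyperbolaPrimitive_hasDerivAt _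
        (hs0.trans_le hb.1).ne').continuousAt.continuousWithinAt
    · intro b hb
      exact hyperbolaPrimitive_hasDerivAt _ (hs0.trans hb.1).ne'
    · intro b hb
      have hb0 : 0 < b := hs0.trans hb.1
      rw [sub_nonneg, le_div_iff₀ hb0]
      nlinarith [hb.2]
  have pieceB : ∀ s, a ≤ s → (1 - a) * (1 - s) ≤ s → s ≤ 1 - a →
      0 ≤ ((1 - a) - (1 - a) ^ 2 / 2) - (s - s ^ 2 / 2) ∧
      ∫⁻ b in Ioc s (1 - a), volume {c | SortedCyclic a b c} = ENNReal.ofReal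
        (((1 - a) - (1 - a) ^ 2 / 2) - (s - s ^ 2 / 2)) := by
    intro s hs hs1 hsm
    refine lintegral_Ioc_of_hasDerivAt (h := fun b => 1 - b)
      (H := fun b => b - b ^ 2 / 2) hsm ?_ ?_ ?_ ?_
    · intro b hb
      exact volume_section_upper_one ha (hs.trans hb.1.le) (by linarith [hb.2])
        (by nlinarith [hb.1])
    · exact fun b _ => (linearPrimitive_hasDerivAt b).continuousAt.continuousWithinAt
    · exact fun b _ => linearPrimitive_hasDerivAt b
    · intro b hb
      linarith [hb.2]
  by_cases hr : a ≤ (3 - √5) / 2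
  · have hroot := (le_root_iff ha1.le).1 hr
    have h2a : 0 < 2 - a := by linarith
    -- The solution b of b = (1 - a)(1 - b), where the lower end of the section changes.
    set t := (1 - a) / (2 - a) with ht
    have ht' : t * (2 - a) = 1 - a := by rw [ht]; field_simp
    have hat : a ≤ t := by rw [ht, le_div_iff₀ h2a]; nlinarith
    have ht1 : t ≤ 1 - a := by
      rw [ht, div_le_iff₀ h2a]; nlinarith
    obtain ⟨A0, A⟩ : 0 ≤ (t + (1 - a) * (1 - t) ^ 2 / 2) - (a + (1 - a) * (1 - a) ^ 2 / 2) ∧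
        ∫⁻ b in Ioc a t, volume {c | SortedCyclic a b c} = ENNReal.ofReal
          ((t + (1 - a) * (1 - t) ^ 2 / 2) - (a + (1 - a) * (1 - a) ^ 2 / 2)) := by
      refine lintegral_Ioc_of_hasDerivAt (h := fun b => 1 - (1 - a) * (1 - b))
        (H := fun b => b + (1 - a) * (1 - b) ^ 2 / 2) hat ?_ ?_ ?_ ?_
      · intro b hb
        exact volume_section_slanted ha hb.1.le (by linarith [hb.2]) (by nlinarith [hb.2])
      · exact fun b _ => (slantedPrimitive_hasDerivAt _ b).continuousAt.continuousWithinAt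
      · exact fun b _ => slantedPrimitive_hasDerivAt _ b
      · intro b hb
        nlinarith [hb.1]
    obtain ⟨B0, B⟩ := pieceB t hat (by linarith) ht1
    obtain ⟨C0, C⟩ := pieceC (1 - a) (by linarith) le_rfl (by linarith) (by nlinarith) h1am
    rw [lintegral_Ioc_split (hat.trans ht1) h1am, lintegral_Ioc_split hat ht1, A, B, C,
      ← ENNReal.ofReal_add A0 B0, ← ENNReal.ofReal_add (add_nonneg A0 B0) C0]
    refine ⟨_, ?_, add_nonneg (add_nonneg A0 B0) C0, rfl⟩
    unfold f1
    rw [if_pos ⟨ha, hr⟩, hlogm, hm2, ← ht]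
    congr 1
    clear_value t m
    linear_combination (1 - t) * ht'
  · have hroot : a ^ 2 - 3 * a + 1 < 0 := by
      by_contra! h
      exact hr ((le_root_iff ha1.le).2 h)
    push Not at hr
    by_cases hh : a ≤ 1 / 2
    · obtain ⟨B0, B⟩ := pieceB a le_rfl (by nlinarith) (by linarith)
      obtain ⟨C0, C⟩ := pieceC (1 - a) (by linarith) le_rfl (by linarith) (by nlinarith) h1am
      rw [lintegral_Ioc_split (by linarith) h1am, B, C, ← ENNReal.ofReal_add B0 C0]
      refine ⟨_, ?_, add_nonneg B0 C0, rfl⟩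
      unfold f1
      rw [if_neg (by rintro ⟨-, h⟩; linarith), if_pos ⟨hr, hh⟩, hlogm, hm2]
      congr 1
      ring
    · push Not at hh
      obtain ⟨C0, C⟩ := pieceC a le_rfl (by linarith) (by linarith) (by nlinarith) ham
      rw [C]
      refine ⟨_, ?_, C0, rfl⟩
      unfold f1
      rw [if_neg (by rintro ⟨-, h⟩; linarith), if_neg (by rintro ⟨-, h⟩; linarith),
        if_pos ⟨hh, hag⟩, hlogm, hm2]
      congr 1
      ring

set_option maxHeartbeats 1000000 in
/-- The area of the slice of the sorted cyclic triples with prescribed middle coordinate at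
most `1 / 2`. -/
lemma area_slice_middle_of_le_half {b : ℝ} (hb : b ≤ 1 / 2) : 0 ≤ f2Left b ∧
    ∫⁻ a, volume {c | SortedCyclic a b c} = ENNReal.ofReal (p3 / 6 * f2Left b) := by
  have hp := p3_pos
  have h5 := two_lt_sqrt_five
  suffices h : ∃ v, f2Left b = 3 / p3 * (2 * v) ∧ 0 ≤ v ∧
      ∫⁻ a, volume {c | SortedCyclic a b c} = ENNReal.ofReal v by
    obtain ⟨v, hv, hv0, h⟩ := h
    refine ⟨by rw [hv]; positivity, ?_⟩
    rw [h, hv]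
    congr 1
    field_simp
    ring
  by_cases hb0 : b < 0
  · refine ⟨0, ?_, le_rfl, ?_⟩
    · unfold f2Left
      rw [if_neg, if_neg]
      · simp
      all_goals rintro ⟨g1, g2⟩; linarith [sqrt_five_lt]
    · have : ∀ a c, ¬ SortedCyclic a b c := by
        rintro b c ⟨g1, g2, g3, g4, g5, g6⟩
        linarith
      simp [this]
  push Not at hb0
  have hsupp : ∀ a, a ∉ Icc 0 b → volume {c | SortedCyclic a b c} = 0 := by
    intro a ha
    refine volume_section_eq_zero ?_
    rintro c ⟨g1, g2, g3, g4, g5, g6⟩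
    exact ha ⟨g1, g2⟩
  rw [lintegral_eq_setLIntegral_Ioc hsupp]
  have pieceA : ∀ s, 0 ≤ s → s ≤ b → b ≤ (1 - s) * (1 - b) →
      0 ≤ (s + (1 - b) * (1 - s) ^ 2 / 2) - (0 + (1 - b) * (1 - 0) ^ 2 / 2) ∧
      ∫⁻ a in Ioc 0 s, volume {c | SortedCyclic a b c} = ENNReal.ofReal
        ((s + (1 - b) * (1 - s) ^ 2 / 2) - (0 + (1 - b) * (1 - 0) ^ 2 / 2)) := by
    intro s hs hsb hs'
    refine lintegral_Ioc_of_hasDerivAt (h := fun a => 1 - (1 - b) * (1 - a))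
      (H := fun a => a + (1 - b) * (1 - a) ^ 2 / 2) hs ?_ ?_ ?_ ?_
    · intro a ha
      rw [volume_section_slanted ha.1.le (ha.2.le.trans hsb) (by linarith [ha.2])
        (by nlinarith [ha.2]), mul_comm]
    · exact fun b _ => (slantedPrimitive_hasDerivAt _ b).continuousAt.continuousWithinAt
    · exact fun b _ => slantedPrimitive_hasDerivAt _ b
    · intro a ha
      nlinarith [ha.1]
  by_cases hr : b ≤ (3 - √5) / 2
  · have hroot := (le_root_iff (by linarith)).1 hr
    obtain ⟨A0, A⟩ := pieceA b hb0 le_rfl (by nlinarith)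
    rw [A]
    refine ⟨_, ?_, A0, rfl⟩
    unfold f2Left
    rw [if_pos ⟨hb0, hr⟩]
    congr 1
    ring
  · have hroot : b ^ 2 - 3 * b + 1 < 0 := by
      by_contra! h
      exact hr ((le_root_iff (by linarith)).2 h)
    push Not at hr
    have h1b : 0 < 1 - b := by linarith
    -- The solution a of b = (1 - a)(1 - b).
    set t := (1 - 2 * b) / (1 - b) with ht
    have ht' : t * (1 - b) = 1 - 2 * b := by rw [ht]; field_simp
    have ht0 : 0 ≤ t := by rw [ht]; apply div_nonneg <;> linarith
    have htb : t ≤ b := by rw [ht, div_le_iff₀ h1b]; nlinarith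
    obtain ⟨A0, A⟩ := pieceA t ht0 htb (by linarith)
    obtain ⟨B0, B⟩ : 0 ≤ (1 - b) * b - (1 - b) * t ∧
        ∫⁻ a in Ioc t b, volume {c | SortedCyclic a b c} = ENNReal.ofReal
          ((1 - b) * b - (1 - b) * t) := by
      refine lintegral_Ioc_of_hasDerivAt (h := fun a => 1 - b)
        (H := fun a => (1 - b) * a) htb ?_ ?_ ?_ ?_
      · intro a ha
        exact volume_section_upper_one (ht0.trans ha.1.le) ha.2.le (by linarith [ha.2])
          (by nlinarith [ha.1])
      · fun_prop
      · intro a _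
        simpa using (hasDerivAt_id a).const_mul (1 - b)
      · exact fun _ _ => h1b.le
    rw [lintegral_Ioc_split ht0 htb, A, B, ← ENNReal.ofReal_add A0 B0]
    refine ⟨_, ?_, add_nonneg A0 B0, rfl⟩
    unfold f2Left
    rw [if_neg (by rintro ⟨-, h⟩; linarith), if_pos ⟨hr, hb⟩, ht]
    field_simp
    ring

/-! ### Order statistics and the reduction to sorted triples -/

lemma orderStat_of_monotone {x : Fin 3 → ℝ} (hx : Monotone x) (i : Fin 3) :
    orderStat i x = x i := by
  rw [orderStat, Tuple.sort_eq_refl_iff_monotone.2 hx]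
  rfl

lemma orderStat_comp_perm (x : Fin 3 → ℝ) (σ : Equiv.Perm (Fin 3)) (i : Fin 3) :
    orderStat i (x ∘ σ) = orderStat i x :=
  congrFun Tuple.comp_perm_comp_sort_eq_comp_sort i

lemma measurableSet_monotone_comp (σ : Equiv.Perm (Fin 3)) :
    MeasurableSet {x : Fin 3 → ℝ | Monotone (x ∘ σ)} := by
  have : {x : Fin 3 → ℝ | Monotone (x ∘ σ)} =
      ⋂ i, ⋂ j, ⋂ (_ : i ≤ j), {x | x (σ i) ≤ x (σ j)} := by
    ext x
    simp [Monotone]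
  rw [this]
  exact .iInter fun i => .iInter fun j => .iInter fun _ =>
    measurableSet_le (measurable_pi_apply _) (measurable_pi_apply _)

lemma measurableSet_strictMono_comp (σ : Equiv.Perm (Fin 3)) :
    MeasurableSet {x : Fin 3 → ℝ | StrictMono (x ∘ σ)} := by
  have : {x : Fin 3 → ℝ | StrictMono (x ∘ σ)} =
      ⋂ i, ⋂ j, ⋂ (_ : i < j), {x | x (σ i) < x (σ j)} := by
    ext x
    simp [StrictMono]
  rw [this]
  exact .iInter fun i => .iInter fun j => .iInter fun _ =>
    measurableSet_lt (measurable_pi_apply _) (measurable_pi_apply _)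

lemma measurable_orderStat (i : Fin 3) : Measurable (orderStat i) := by
  refine measurable_of_Iic fun t => ?_
  have : orderStat i ⁻¹' Iic t =
      ⋃ σ : Equiv.Perm (Fin 3), {x | Monotone (x ∘ σ)} ∩ {x | x (σ i) ≤ t} := by
    ext x
    simp only [mem_preimage, mem_Iic, mem_iUnion, mem_inter_iff, mem_ofPred_eq]
    constructor
    · intro h
      exact ⟨Tuple.sort x, Tuple.monotone_sort x, h⟩
    · rintro ⟨σ, hσ, h⟩
      have := congrFun (Tuple.unique_monotone hσ (Tuple.monotone_sort x)) i
      simp only [Function.comp_apply] at this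
      rwa [orderStat, ← this]
  rw [this]
  exact .iUnion fun σ => (measurableSet_monotone_comp σ).inter
    (measurableSet_le (measurable_pi_apply _) measurable_const)

lemma measurableSet_hasSmallCoord : MeasurableSet {x | HasSmallCoord x} := by
  have : {x | HasSmallCoord x} = {x : Fin 3 → ℝ | x 0 + x 1 * x 2 ≤ 1} ∪
      ({x | x 1 + x 0 * x 2 ≤ 1} ∪ {x | x 2 + x 0 * x 1 ≤ 1}) := by
    ext x
    exact hasSmallCoord_iff
  rw [this]
  refine .union ?_ (.union ?_ ?_) <;>
  exact measurableSet_le (by fun_prop) measurable_const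

lemma measurableSet_cyclicTriples : MeasurableSet cyclicTriples := by
  have : cyclicTriples = (⋂ i, {x | x i ∈ Icc (0 : ℝ) 1}) ∩
      ({x | HasSmallCoord x} ∩ (fun x => 1 - x) ⁻¹' {x | HasSmallCoord x}) := by
    ext x
    rw [mem_cyclicTriples]
    simp only [mem_inter_iff, mem_iInter, mem_ofPred_eq, mem_preimage]
  rw [this]
  refine .inter (.iInter fun i => measurable_pi_apply i measurableSet_Icc)
    (measurableSet_hasSmallCoord.inter (measurableSet_hasSmallCoord.preimage ?_))
  fun_prop

lemma comp_perm_mem_cyclicTriples {x : Fin 3 → ℝ} (hx : x ∈ cyclicTriples)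
    (σ : Equiv.Perm (Fin 3)) : x ∘ σ ∈ cyclicTriples := by
  rw [mem_cyclicTriples] at hx ⊢
  exact ⟨fun i => hx.1 _, hx.2.1.comp_perm σ, hx.2.2.comp_perm σ⟩

lemma mem_cyclicTriples_iff_sortedCyclic {x : Fin 3 → ℝ} (hx : Monotone x) :
    x ∈ cyclicTriples ↔ SortedCyclic (x 0) (x 1) (x 2) := by
  have h01 : x 0 ≤ x 1 := hx (by decide)
  have h12 : x 1 ≤ x 2 := hx (by decide)
  rw [mem_cyclicTriples, hasSmallCoord_iff, hasSmallCoord_iff]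
  simp only [Pi.sub_apply, Pi.one_apply]
  constructor
  · rintro ⟨h, h1, h2⟩
    have a0 := (h 0).1
    have c1 := (h 2).2
    refine ⟨a0, h01, h12, c1, ?_, ?_⟩
    -- For sorted triples in the cube, a + bc is the least of the three sums, so any small
    -- coordinate makes the smallest one small. The same applies to 1 - x, whose smallest coordinate
    -- is 1 - c.
    · rcases h1 with h1 | h1 | h1
      · exact h1
      · nlinarith
      · nlinarith
    · rcases h2 with h2 | h2 | h2
      · nlinarith
      · nlinarith
      · linarith
  · rintro ⟨a0, -, -, c1, g1, g2⟩
    refine ⟨fun i => ?_, Or.inl g1, Or.inr (Or.inr (by linarith))⟩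
    fin_cases i
    · exact ⟨a0, by simp only [Fin.zero_eta]; linarith⟩
    · exact ⟨by simp only [Fin.mk_one]; linarith, by simp only [Fin.mk_one]; linarith⟩
    · exact ⟨a0.trans (h01.trans h12), c1⟩

lemma ae_injective : ∀ᵐ x : Fin 3 → ℝ, Function.Injective x := by
  have h : ∀ i j : Fin 3, i ≠ j → ∀ᵐ x : Fin 3 → ℝ, x i ≠ x j := by
    intro i j hij
    let L : (Fin 3 → ℝ) →ₗ[ℝ] ℝ :=
      (LinearMap.proj i : (Fin 3 → ℝ) →ₗ[ℝ] ℝ) - LinearMap.proj j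
    have hL : LinearMap.ker L ≠ ⊤ := by
      intro h
      have h1 : Pi.single i (1 : ℝ) ∈ LinearMap.ker L := by rw [h]; trivial
      simp [L, hij] at h1
    have := Measure.addHaar_submodule (volume : Measure (Fin 3 → ℝ)) _ hL
    rw [ae_iff]
    refine measure_mono_null (fun x hx => ?_) this
    simp only [ne_eq, not_not, mem_ofPred_eq] at hx
    simp [L, hx]
  have h' : ∀ᵐ x : Fin 3 → ℝ, ∀ i j : Fin 3, i ≠ j → x i ≠ x j := by
    simp only [ae_all_iff]
    exact h
  filter_upwards [h'] with x hx i j hij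
  by_contra hne
  exact hx i j hne hij

lemma measurePreserving_comp_perm (σ : Equiv.Perm (Fin 3)) :
    MeasurePreserving (fun x : Fin 3 → ℝ => x ∘ σ) volume volume := by
  have h := volume_measurePreserving_piCongrLeft (fun _ : Fin 3 => ℝ) σ.symm
  convert h using 1
  ext x i
  simp [MeasurableEquiv.coe_piCongrLeft, Equiv.piCongrLeft_apply, eq_rec_constant]

/-- Off the null set of ties, each triple lies in exactly one of the six open chambers, which
coordinate permutations carry to one another preserving volume. -/
lemma volume_eq_six_mul {E : Set (Fin 3 → ℝ)} (hE : MeasurableSet E)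
    (hperm : ∀ x ∈ E, ∀ σ : Equiv.Perm (Fin 3), x ∘ σ ∈ E) :
    volume E = 6 * volume (E ∩ {x | Monotone x}) := by
  have hS : MeasurableSet (E ∩ {x : Fin 3 → ℝ | StrictMono x}) :=
    hE.inter (measurableSet_strictMono_comp 1)
  have hcong : volume (E ∩ {x | Monotone x}) = volume (E ∩ {x | StrictMono x}) := by
    refine measure_congr ?_
    filter_upwards [ae_injective] with x hx
    apply propext
    exact and_congr_right fun _ =>
      ⟨fun h : Monotone x => h.strictMono_of_injective hx, fun h : StrictMono x => h.monotone⟩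
  have hunion : E =ᵐ[volume] ⋃ σ : Equiv.Perm (Fin 3),
      (fun x : Fin 3 → ℝ => x ∘ σ) ⁻¹' (E ∩ {x | StrictMono x}) := by
    filter_upwards [ae_injective] with x hx
    apply propext
    change x ∈ E ↔ x ∈ ⋃ σ : Equiv.Perm (Fin 3),
      (fun x : Fin 3 → ℝ => x ∘ σ) ⁻¹' (E ∩ {x | StrictMono x})
    simp only [mem_iUnion, mem_preimage, mem_inter_iff, mem_ofPred_eq]
    constructor
    · intro h
      exact ⟨Tuple.sort x, hperm x h _, (Tuple.monotone_sort x).strictMono_of_injective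
        (hx.comp (Equiv.injective _))⟩
    · rintro ⟨σ, h, -⟩
      have := hperm _ h σ.symm
      rwa [Function.comp_assoc, Equiv.self_comp_symm, Function.comp_id] at this
  rw [hcong, measure_congr hunion, measure_iUnion]
  · simp only [(measurePreserving_comp_perm _).measure_preimage hS.nullMeasurableSet]
    rw [tsum_fintype, Finset.sum_const, Finset.card_univ, Fintype.card_perm, Fintype.card_fin,
      nsmul_eq_mul]
    rfl
  · intro σ τ hne
    refine Set.disjoint_left.2 fun x h1 h2 => hne ?_
    have hσ : StrictMono (x ∘ σ) := h1.2
    have hτ : StrictMono (x ∘ τ) := h2.2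
    have h := Tuple.unique_monotone hσ.monotone hτ.monotone
    have hinj : Function.Injective x := by
      have := hσ.injective.comp σ.symm.injective
      rwa [Function.comp_assoc, Equiv.self_comp_symm, Function.comp_id] at this
    exact Equiv.ext fun i => hinj (congrFun h i)
  · intro σ
    exact (measurePreserving_comp_perm σ).measurable hS

lemma volume_orderStat_preimage (i : Fin 3) {B : Set ℝ} (hB : MeasurableSet B) :
    volume (cyclicTriples ∩ orderStat i ⁻¹' B) =
      6 * volume {x : Fin 3 → ℝ | SortedCyclic (x 0) (x 1) (x 2) ∧ x i ∈ B} := by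
  rw [volume_eq_six_mul (measurableSet_cyclicTriples.inter (measurable_orderStat i hB))]
  · congr 2
    ext x
    simp only [mem_inter_iff, mem_preimage, mem_ofPred_eq]
    constructor
    · rintro ⟨⟨h1, h2⟩, h3⟩
      rw [orderStat_of_monotone h3] at h2
      exact ⟨(mem_cyclicTriples_iff_sortedCyclic h3).1 h1, h2⟩
    · rintro ⟨h1, h2⟩
      have h3 : Monotone x := by
        rw [Fin.monotone_iff_le_succ]
        intro j
        fin_cases j
        · exact h1.2.1
        · exact h1.2.2.1
      exact ⟨⟨(mem_cyclicTriples_iff_sortedCyclic h3).2 h1, by rwa [orderStat_of_monotone h3]⟩, h3⟩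
  · rintro x ⟨h1, h2⟩ σ
    refine ⟨comp_perm_mem_cyclicTriples h1 σ, ?_⟩
    rw [mem_preimage, orderStat_comp_perm]
    exact h2

/-! ### Slicing and reflection -/

lemma measurePreserving_coordinates (i : Fin 3) :
    MeasurePreserving (fun x : Fin 3 → ℝ => (x i, x (i.succAbove 0), x (i.succAbove 1)))
      volume volume := by
  have h := ((MeasurePreserving.id (volume : Measure ℝ)).prod
    (volume_preserving_finTwoArrow ℝ)).comp (volume_preserving_piFinSuccAbove (fun _ => ℝ) i)
  exact h

lemma measurableSet_sortedCyclic {α : Type*} [MeasurableSpace α] {f g h : α → ℝ}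
    (hf : Measurable f) (hg : Measurable g) (hh : Measurable h) :
    MeasurableSet {x | SortedCyclic (f x) (g x) (h x)} := by
  simp only [SortedCyclic, ofPred_and]
  refine .inter (measurableSet_le ?_ ?_) (.inter (measurableSet_le ?_ ?_)
    (.inter (measurableSet_le ?_ ?_) (.inter (measurableSet_le ?_ ?_)
    (.inter (measurableSet_le ?_ ?_) (measurableSet_le ?_ ?_))))) <;> fun_prop

/-- Integration over slices for a region in space described by a predicate. -/
lemma volume_eq_lintegral_slices {R : ℝ → ℝ → ℝ → Prop}
    (hR : MeasurableSet {z : ℝ × ℝ × ℝ | R z.1 z.2.1 z.2.2}) {B : Set ℝ} (hB : MeasurableSet B)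
    (i : Fin 3) :
    volume {x : Fin 3 → ℝ | R (x i) (x (i.succAbove 0)) (x (i.succAbove 1)) ∧ x i ∈ B} =
      ∫⁻ t in B, ∫⁻ u, volume {v | R t u v} := by
  have hm : MeasurableSet {z : ℝ × ℝ × ℝ | R z.1 z.2.1 z.2.2 ∧ z.1 ∈ B} :=
    hR.inter (measurable_fst hB)
  have := (measurePreserving_coordinates i).measure_preimage hm.nullMeasurableSet
  refine this.trans ?_
  rw [Measure.volume_eq_prod, Measure.prod_apply hm, ← lintegral_indicator hB]
  refine lintegral_congr fun t => ?_
  by_cases ht : t ∈ B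
  · rw [indicator_of_mem ht, Measure.volume_eq_prod,
      Measure.prod_apply (measurable_prodMk_left hm)]
    refine lintegral_congr fun u => ?_
    congr 1
    ext v
    simp [ht]
  · rw [indicator_of_notMem ht]
    have : Prod.mk t ⁻¹' {z : ℝ × ℝ × ℝ | R z.1 z.2.1 z.2.2 ∧ z.1 ∈ B} = ∅ := by
      ext z
      simp [ht]
    rw [this, measure_empty]

lemma SortedCyclic.reflect {a b c : ℝ} (h : SortedCyclic a b c) :
    SortedCyclic (1 - c) (1 - b) (1 - a) := by
  obtain ⟨h1, h2, h3, h4, h5, h6⟩ := h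
  exact ⟨by linarith, by linarith, by linarith, by linarith, by linarith, by linarith⟩

lemma sortedCyclic_reflect_iff {a b c : ℝ} :
    SortedCyclic (1 - c) (1 - b) (1 - a) ↔ SortedCyclic a b c :=
  ⟨fun h => by simpa using h.reflect, SortedCyclic.reflect⟩

lemma area_slice_middle_reflect (b : ℝ) :
    ∫⁻ a, volume {c | SortedCyclic a (1 - b) c} = ∫⁻ a, volume {c | SortedCyclic a b c} := by
  have hm : ∀ b, MeasurableSet {z : ℝ × ℝ | SortedCyclic z.1 b z.2} := fun b =>
    measurableSet_sortedCyclic measurable_fst measurable_const measurable_snd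
  have e : ∀ b, ∫⁻ a, volume {c | SortedCyclic a b c} =
      volume {z : ℝ × ℝ | SortedCyclic z.1 b z.2} := by
    intro b
    rw [Measure.volume_eq_prod, Measure.prod_apply (hm b)]
    rfl
  have hsub : MeasurePreserving (fun t : ℝ => 1 - t) volume volume :=
    Measure.measurePreserving_sub_left volume 1
  have h := ((hsub.prod hsub).comp
    (Measure.measurePreserving_swap (μ := (volume : Measure ℝ)) (ν := (volume : Measure ℝ)))).measure_preimage
      (hm (1 - b)).nullMeasurableSet
  rw [e, e, Measure.volume_eq_prod, ← h]
  congr 1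
  ext ⟨a, c⟩
  exact sortedCyclic_reflect_iff

lemma f2_reflect (x : ℝ) : f2 (1 - x) = f2 x := by
  have h0 : ∀ x, x < 0 → f2Left x = 0 := by
    intro x hx
    unfold f2Left
    rw [if_neg, if_neg]
    all_goals rintro ⟨g1, g2⟩; linarith [sqrt_five_lt]
  have h1 : ∀ x, 1 / 2 < x → f2Left x = 0 := by
    intro x hx
    unfold f2Left
    rw [if_neg, if_neg]
    all_goals rintro ⟨g1, g2⟩; linarith [two_lt_sqrt_five]
  have key : ∀ x, 1 / 2 < x → f2 x = f2Left (1 - x) := by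
    intro x hx
    unfold f2
    by_cases h : x ≤ 1
    · rw [if_pos ⟨hx, h⟩]
    · rw [if_neg fun g => h g.2, h1 x hx, h0]
      linarith
  have key' : ∀ x, x ≤ 1 / 2 → f2 x = f2Left x := by
    intro x hx
    unfold f2
    rw [if_neg fun g => by linarith [g.1]]
  rcases lt_trichotomy x (1 / 2) with h | h | h
  · rw [key (1 - x) (by linarith), key' x h.le, sub_sub_cancel]
  · rw [h]; norm_num
  · rw [key x h, key' (1 - x) (by linarith)]

lemma area_slice_middle (b : ℝ) : 0 ≤ f2 b ∧
    ∫⁻ a, volume {c | SortedCyclic a b c} = ENNReal.ofReal (p3 / 6 * f2 b) := by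
  have key : ∀ b, b ≤ 1 / 2 → 0 ≤ f2 b ∧
      ∫⁻ a, volume {c | SortedCyclic a b c} = ENNReal.ofReal (p3 / 6 * f2 b) := by
    intro b hb
    have : f2 b = f2Left b := by
      unfold f2
      rw [if_neg fun g => by linarith [g.1]]
    rw [this]
    exact area_slice_middle_of_le_half hb
  rcases le_or_gt b (1 / 2) with h | h
  · exact key b h
  · have := key (1 - b) (by linarith)
    rwa [f2_reflect, area_slice_middle_reflect] at this

lemma volume_sorted_min {B : Set ℝ} (hB : MeasurableSet B) :
    volume {x : Fin 3 → ℝ | SortedCyclic (x 0) (x 1) (x 2) ∧ x 0 ∈ B} =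
      ∫⁻ t in B, ENNReal.ofReal (p3 / 6 * f1 t) := by
  refine (volume_eq_lintegral_slices (R := fun a b c => SortedCyclic a b c)
    (measurableSet_sortedCyclic (by fun_prop) (by fun_prop) (by fun_prop)) hB 0).trans ?_
  exact lintegral_congr fun t => (area_slice_min t).2

lemma volume_sorted_middle {B : Set ℝ} (hB : MeasurableSet B) :
    volume {x : Fin 3 → ℝ | SortedCyclic (x 0) (x 1) (x 2) ∧ x 1 ∈ B} =
      ∫⁻ t in B, ENNReal.ofReal (p3 / 6 * f2 t) := by
  refine (volume_eq_lintegral_slices (R := fun b a c => SortedCyclic a b c)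
    (measurableSet_sortedCyclic (by fun_prop) (by fun_prop) (by fun_prop)) hB 1).trans ?_
  exact lintegral_congr fun t => (area_slice_middle t).2

/-- Reversing the coordinates and subtracting from 1 preserves volume and the sorted region, and
turns largest coordinate t into smallest coordinate 1 - t. -/
lemma volume_sorted_max {B : Set ℝ} (hB : MeasurableSet B) :
    volume {x : Fin 3 → ℝ | SortedCyclic (x 0) (x 1) (x 2) ∧ x 2 ∈ B} =
      ∫⁻ t in B, ENNReal.ofReal (p3 / 6 * f1 (1 - t)) := by
  have hsub : MeasurePreserving (fun t : ℝ => 1 - t) volume volume :=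
    Measure.measurePreserving_sub_left volume 1
  have hrev : MeasurePreserving (fun x : Fin 3 → ℝ => 1 - x ∘ Fin.revPerm) volume volume :=
    (Measure.measurePreserving_sub_left volume (1 : Fin 3 → ℝ)).comp
      (measurePreserving_comp_perm Fin.revPerm)
  have hB' : MeasurableSet ((fun t : ℝ => 1 - t) ⁻¹' B) := hsub.measurable hB
  have h0 : MeasurableSet {x : Fin 3 → ℝ | x 0 ∈ (fun t : ℝ => 1 - t) ⁻¹' B} :=
    hB'.preimage (measurable_pi_apply 0)
  have hm : MeasurableSet {x : Fin 3 → ℝ | SortedCyclic (x 0) (x 1) (x 2) ∧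
      x 0 ∈ (fun t : ℝ => 1 - t) ⁻¹' B} :=
    (measurableSet_sortedCyclic (by fun_prop) (by fun_prop) (by fun_prop)).inter
      h0
  have h := hrev.measure_preimage hm.nullMeasurableSet
  rw [volume_sorted_min hB'] at h
  have h2 := hsub.setLIntegral_comp_preimage_emb (MeasurableEquiv.subLeft (1 : ℝ)).measurableEmbedding
    (fun t => ENNReal.ofReal (p3 / 6 * f1 (1 - t))) B
  simp only [sub_sub_cancel] at h2
  rw [← h2, ← h]
  congr 1
  ext x
  refine and_congr (sortedCyclic_reflect_iff (a := x 0) (b := x 1) (c := x 2)).symm ?_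
  change x 2 ∈ B ↔ 1 - (1 - x 2) ∈ B
  rw [sub_sub_cancel]

lemma lintegral_Ioc_of_reflect {g : ℝ → ENNReal} (hg : ∀ x, g (1 - x) = g x) :
    ∫⁻ x in Ioc (1 / 2) 1, g x = ∫⁻ x in Ioc 0 (1 / 2), g x := by
  have hsub : MeasurePreserving (fun t : ℝ => 1 - t) volume volume :=
    Measure.measurePreserving_sub_left volume 1
  have h := hsub.setLIntegral_comp_preimage_emb
    (MeasurableEquiv.subLeft (1 : ℝ)).measurableEmbedding g (Ico 0 (1 / 2))
  simp only [hg] at h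
  have e : (fun t : ℝ => 1 - t) ⁻¹' Ico 0 (1 / 2) = Ioc (1 / 2) 1 := by
    ext t
    simp only [mem_preimage, mem_Ico, mem_Ioc]
    constructor <;> rintro ⟨h1, h2⟩ <;> constructor <;> linarith
  rw [e] at h
  rw [h]
  exact setLIntegral_congr Ico_ae_eq_Ioc

/-! ### Total volume and the densities -/

/-- The total mass of the unnormalised density of the middle coordinate. -/
lemma lintegral_middle :
    ∫⁻ t, ENNReal.ofReal (p3 / 6 * f2 t) = ENNReal.ofReal (p3 / 6) := by
  have hp := p3_pos
  have h5 := two_lt_sqrt_five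
  have h5' := sqrt_five_lt
  have hsq := sq_sqrt_five
  set r := (3 - √5) / 2 with hr
  have hr0 : 0 ≤ r := by rw [hr]; linarith
  have hr2 : r ≤ 1 / 2 := by rw [hr]; linarith
  have f2_left : ∀ x, x ≤ 1 / 2 → f2 x = f2Left x := by
    intro x hx
    unfold f2
    rw [if_neg fun g => by linarith [g.1]]
  have hf2 : ∀ x, 0 ≤ f2 x := fun x => (area_slice_middle x).1
  have hneg : ∀ x, x < 0 → f2 x = 0 := by
    intro x hx
    rw [f2_left x (by linarith)]
    unfold f2Left
    rw [if_neg, if_neg]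
    all_goals rintro ⟨g1, g2⟩; linarith
  have hsupp : ∀ x, x ∉ Icc 0 1 → ENNReal.ofReal (p3 / 6 * f2 x) = 0 := by
    intro x hx
    have : f2 x = 0 := by
      by_cases h : x < 0
      · exact hneg x h
      · rw [← f2_reflect]
        apply hneg
        by_contra h'
        exact hx ⟨by linarith, by linarith⟩
    simp [this]
  obtain ⟨A0, A⟩ := lintegral_Ioc_of_hasDerivAt
    (g := fun t => ENNReal.ofReal (p3 / 6 * f2 t)) (h := fun t => p3 / 6 * f2 t)
    (H := fun t => (t ^ 3 - t ^ 4 / 4) / 2) hr0 (fun _ _ => rfl) (by fun_prop)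
    (by
      intro x hx
      have : p3 / 6 * f2 x = (3 * x ^ 2 - x ^ 3) / 2 := by
        rw [f2_left x (hx.2.le.trans hr2)]
        unfold f2Left
        rw [if_pos ⟨hx.1.le, hx.2.le⟩]
        field_simp
        ring
      simp only [this]
      refine ((((hasDerivAt_id' x).pow 3).sub
        (((hasDerivAt_id' x).pow 4).div_const 4)).div_const 2).congr_deriv ?_
      simp only [Nat.cast_ofNat]
      ring)
    (fun x _ => mul_nonneg (by positivity) (hf2 x))
  have hder : ∀ x : ℝ, x < 1 → HasDerivAt
      (fun t => 3 / 2 * t ^ 2 - t ^ 3 / 3 + Real.log (1 - t) / 2)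
      (3 * x - x ^ 2 - 1 / (2 * (1 - x))) x := by
    intro x hx
    have h1x : 1 - x ≠ 0 := by linarith
    refine (((((hasDerivAt_id' x).pow 2).const_mul (3 / 2)).sub
      (((hasDerivAt_id' x).pow 3).div_const 3)).add
      ((((hasDerivAt_id' x).const_sub 1).log h1x).div_const 2)).congr_deriv ?_
    simp only [Nat.cast_ofNat]
    field_simp
    ring
  obtain ⟨B0, B⟩ := lintegral_Ioc_of_hasDerivAt
    (g := fun t => ENNReal.ofReal (p3 / 6 * f2 t)) (h := fun t => p3 / 6 * f2 t)
    (H := fun t => 3 / 2 * t ^ 2 - t ^ 3 / 3 + Real.log (1 - t) / 2) hr2 (fun _ _ => rfl)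
    (fun x hx => (hder x (by linarith [hx.2])).continuousAt.continuousWithinAt)
    (by
      intro x hx
      have : p3 / 6 * f2 x = 3 * x - x ^ 2 - 1 / (2 * (1 - x)) := by
        rw [f2_left x hx.2.le]
        unfold f2Left
        rw [if_neg (fun g => by linarith [g.2, hx.1]), if_pos ⟨hx.1, hx.2.le⟩, ← mul_assoc,
          div_mul_div_comm, mul_comm p3, div_self (by positivity), one_mul]
      simp only [this]
      exact hder x (by linarith [hx.2]))
    (fun x _ => mul_nonneg (by positivity) (hf2 x))
  rw [lintegral_eq_setLIntegral_Ioc hsupp,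
    lintegral_Ioc_split (by norm_num : (0 : ℝ) ≤ 1 / 2) (by norm_num),
    lintegral_Ioc_of_reflect (fun x => by rw [f2_reflect]), lintegral_Ioc_split hr0 hr2, A, B,
    ← ENNReal.ofReal_add A0 B0, ← ENNReal.ofReal_add (add_nonneg A0 B0) (add_nonneg A0 B0)]
  congr 1
  have hlog : Real.log (1 - r) = Real.log (√5 - 1) - Real.log 2 := by
    rw [← Real.log_div (by linarith) (by norm_num), hr]
    congr 1
    ring
  have hlog2 : Real.log (1 - 1 / 2) = -Real.log 2 := by
    rw [← Real.log_inv]; norm_num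
  rw [hlog, hlog2]
  -- As a root of x² - 3x + 1, r has all its powers linear in r.
  have r2 : r ^ 2 = 3 * r - 1 := by rw [hr]; linear_combination hsq / 4
  have r3 : r ^ 3 = 8 * r - 3 := by linear_combination (r + 3) * r2
  have r4 : r ^ 4 = 21 * r - 8 := by linear_combination r * r3 + 8 * r2
  rw [r2, r3, r4, hr]
  unfold p3
  ring

/-- The middle coordinate is the convenient one to integrate: its slice areas are rational on each
piece and symmetric about 1/2. -/
lemma volume_sorted : volume {x : Fin 3 → ℝ | SortedCyclic (x 0) (x 1) (x 2)} =
    ENNReal.ofReal (p3 / 6) := by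
  have := volume_sorted_middle MeasurableSet.univ
  simpa [lintegral_middle] using this

theorem volume_cyclicTriples : volume cyclicTriples = ENNReal.ofReal p3 := by
  have := volume_orderStat_preimage 0 MeasurableSet.univ
  simp only [preimage_univ, inter_univ, mem_univ, and_true] at this
  rw [this, volume_sorted, ← ENNReal.ofReal_ofNat 6, ← ENNReal.ofReal_mul (by norm_num)]
  congr 1
  ring

lemma hasDensity_of_volume_sorted {Ω : Type*} [MeasurableSpace Ω] {P : Measure Ω}
    {X : Ω → Fin 3 → ℝ} (hX : Measurable X) (hU : pdf.IsUniform X cyclicTriples P volume)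
    {i : Fin 3} {f : ℝ → ℝ} (hf : Measurable f) (hf0 : ∀ x, 0 ≤ f x)
    (h : ∀ B : Set ℝ, MeasurableSet B →
      volume {x : Fin 3 → ℝ | SortedCyclic (x 0) (x 1) (x 2) ∧ x i ∈ B} =
        ∫⁻ t in B, ENNReal.ofReal (p3 / 6 * f t)) :
    HasDensity P (fun ω => orderStat i (X ω)) f := by
  have hp := p3_pos
  refine ⟨(measurable_orderStat i).comp hX, hf, hf0, ?_⟩
  have hmap : P.map (fun ω => orderStat i (X ω)) = (P.map X).map (orderStat i) :=
    (Measure.map_map (measurable_orderStat i) hX).symm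
  rw [hmap, hU]
  ext B hB
  rw [Measure.map_apply (measurable_orderStat i) hB, cond_apply measurableSet_cyclicTriples,
    volume_orderStat_preimage i hB, h B hB, withDensity_apply _ hB, volume_cyclicTriples]
  have e : ∀ t, ENNReal.ofReal (p3 / 6 * f t) =
      ENNReal.ofReal (p3 / 6) * ENNReal.ofReal (f t) := fun t =>
    ENNReal.ofReal_mul (by positivity)
  simp only [e]
  rw [lintegral_const_mul _ hf.ennreal_ofReal, ← mul_assoc, ← mul_assoc,
    ← ENNReal.ofReal_inv_of_pos hp, ← ENNReal.ofReal_ofNat 6,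
    ← ENNReal.ofReal_mul (by positivity), ← ENNReal.ofReal_mul (by positivity)]
  have : p3⁻¹ * 6 * (p3 / 6) = 1 := by field_simp
  rw [this, ENNReal.ofReal_one, one_mul]

lemma measurable_f1 : Measurable f1 := by
  unfold f1
  refine Measurable.ite measurableSet_Icc (by fun_prop) (Measurable.ite measurableSet_Ioc
    (by fun_prop) (Measurable.ite measurableSet_Ioc (by fun_prop) measurable_const))

lemma measurable_f2 : Measurable f2 := by
  have h : Measurable f2Left := by
    unfold f2Left
    refine Measurable.ite measurableSet_Icc (by fun_prop) (Measurable.ite measurableSet_Ioc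
      (by fun_prop) measurable_const)
  unfold f2
  exact Measurable.ite measurableSet_Ioc (by fun_prop) h

theorem theorem3 :
    (volume cyclicTriples = ENNReal.ofReal p3 ∧ 0 < p3) ∧
    (∀ x, f2 (1 - x) = f2 x) ∧
    ∀ (Ω : Type*) [MeasurableSpace Ω] (P : Measure Ω) [IsProbabilityMeasure P]
      (X : Ω → Fin 3 → ℝ), Measurable X →
      pdf.IsUniform X cyclicTriples P volume →
        HasDensity P (fun ω => orderStat 0 (X ω)) f1 ∧
        HasDensity P (fun ω => orderStat 1 (X ω)) f2 ∧
        HasDensity P (fun ω => orderStat 2 (X ω)) (fun x => f1 (1 - x)) := by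
  refine ⟨⟨volume_cyclicTriples, p3_pos⟩, f2_reflect, fun _ _ _ _ _ hX hU => ⟨?_, ?_, ?_⟩⟩
  · exact hasDensity_of_volume_sorted hX hU measurable_f1 (fun x => (area_slice_min x).1)
      fun B hB => volume_sorted_min hB
  · exact hasDensity_of_volume_sorted hX hU measurable_f2 (fun x => (area_slice_middle x).1)
      fun B hB => volume_sorted_middle hB
  · exact hasDensity_of_volume_sorted hX hU (measurable_f1.comp (measurable_const.sub measurable_id))
      (fun x => (area_slice_min (1 - x)).1) fun B hB => volume_sorted_max hB
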